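/- **Conventions.** A graph is a finite CW complex of dimension at most one. The valence $d(v)$ of a vertex $v$ is the number of ends of edges at $v$; $v$ is *essential* if $d(v)\ge 3$, and *separating* if $\Gamma\setminus\{v\}$ is disconnected. The closed star of $v$ is the union of $v$ and the closed edges at $v$, and its open star is the union of $v$ and the open edges at $v$. For a space $X$ and $S\subseteq X$, $B_k(X,S)$ is the quotient by $\Sigma_k$ of $\{(x_1,\dots,x_k)\in X^k : x_i=x_j\Rightarrow i=j\text{ or }x_i\in S\}$, and $B_k(X)=B_k(X,\varnothing)$. The star graph $\mathsf S_n$ is the cone on $\{1,\dots,n\}$, with central vertex $v_0$ and leaves $v_1,\dots,v_n$. Two homomorphisms $f_0,f_1$ into a group $G$ have *disjoint conjugates* if, for $h\in\operatorname{im}f_0$ and $g\in G$, one has $ghg^{-1}\in\operatorname{im}f_1$ if and only if $h=1$. Let $\Gamma$ be a connected graph, subdivided so that it has no self-loops or multiple edges, every vertex adjacent to an essential vertex has valence $2$, and distinct essential vertices have disjoint closed stars. **Detection homomorphism.** For a vertex $v$, call two edges at $v$ equivalent if they lie in the same component of $\Gamma\setminus\{v\}$. The local graph $\Lambda(v)$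 has a central vertex and one further vertex (a *sink*) for each equivalence class, joined to the central vertex by edges indexed by the elements of that class; write $B_k(\Lambda(v))$ for its configuration space with collisions permitted in the set of sinks. The quotient map $q_v:\Gamma\to\Lambda(v)$ is the identity on the open star of $v$ and sends any other point to the sink indexed by its component in $\Gamma\setminus\{v\}$. For $x_0\in B_k(\Gamma)$, let $$\delta:\pi_1(B_k(\Gamma),x_0)\to\prod_v\pi_1(B_k(\Lambda(v)),q_v(x_0))$$ be the homomorphism with components $(q_v)_*$, the product being over all essential vertices of $\Gamma$. **Toric homomorphisms.** Let $\epsilon:S^1\to B_2(\mathsf S_3)$ be the loop at $\{v_1,v_2\}$ which is the concatenation of the three paths in which, in turn, one particle rests at $v_1$ while the other moves from $v_2$ to $v_3$, one rests at $v_3$ while the other moves from $v_1$ to $v_2$, and one rests at $v_2$ while the other moves from $v_3$ to $v_1$, each motion being piecewise linear through $v_0$. For $a\in\{0,1\}$ and $n\ge a+3$, let $\iota_a:B_2(\mathsf S_3)\to B_2(\mathsf S_n)$ be induced by the embedding sending the $i$th edge to the $(i+a)$th. For an edge $e_i$ of $\mathsf S_3$, let $\sigma_i:B_2(\mathsf S_3)\to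 B_3(\mathsf S_3)$ replace the particles $x_1<\dots<x_\ell$ on the closed edge $\overline{e_i}\cong[0,1]$ by the $\ell+1$ averages $\frac12(x_j+x_{j+1})$, $0\le j\le\ell$, where $x_0=0$ and $x_{\ell+1}=1$. Let $W$ be a set of essential vertices, and write $W=W_0\sqcup W_1\sqcup W_2$, where $W_0$ consists of the vertices in $W$ of valence at least $4$, $W_1$ of the separating trivalent ones, and $W_2$ of the non-separating trivalent ones. Set $k(v)=3$ for $v\in W_1$ and $k(v)=2$ otherwise, and $k=\sum_{v\in W}k(v)$. Fix an ordering of the edges at each $v\in W$ such that, if $v$ is separating, the first two edges lie in different components of $\Gamma\setminus\{v\}$. For $v\in W$ and $a\in\{0,1\}$, define $\varphi_v^a:S^1\to B_{k(v)}(\mathsf S_{d(v)})$ by * $\varphi_v^a=\iota_a\circ\epsilon$ if $v\in W_0$; * $\varphi_v^a=\sigma_{a+1}\circ\epsilon$ if $v\in W_1$; * $\varphi_v^0=\epsilon$ and $\varphi_v^1$ constant with value $\{v_1,v_2\}$ if $v\in W_2$. The order-preserving linear identifications of the $\mathsf S_{d(v)}$ with the (disjoint) closed stars of the vertices $v\in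 W$ give rise to a map $$\varphi_W^a:(S^1)^W\to\prod_{v\in W}B_{k(v)}(\mathsf S_{d(v)})\to B_k(\Gamma).$$ Fix a basepoint $x_0\in B_k(\Gamma)$ and, for each $a\in\{0,1\}$, a path $\alpha^a$ in $B_k(\Gamma)$ from $\varphi_W^a(1)$ to $x_0$. The toric homomorphism $\tau_W^a$ is the composite $$\mathbb Z^W\cong\pi_1(S^1,1)^W\xrightarrow{(\varphi_W^a)_*}\pi_1(B_k(\Gamma),\varphi_W^a(1))\xrightarrow{\hat\alpha^a}\pi_1(B_k(\Gamma),x_0),$$ where $\hat\alpha^a$ is the change-of-basepoint isomorphism. **Proposition.** For every such $\Gamma$ and $W$ and all choices of orderings, basepoint and paths as above: 1. The composite $\delta\circ\tau_W^0$ is injective. 2. The restrictions of $\delta\circ\tau_W^1$ to $\mathbb Z^{W_0\sqcup W_1}$ and $\mathbb Z^{W_2}$ are injective and trivial, respectively. 3. The homomorphisms $\delta\circ\tau_W^0$ and $\delta\circ\tau_W^1$ have disjoint conjugates. -/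

import Mathlib

namespace GraphBraid

open Set Topology

universe u v w z

section Configurations

set_option linter.unusedSectionVars false

variable (ι : Type u) (X : Type v) [TopologicalSpace X] (S : Set X)

/-- Ordered configurations in `X`, labelled by `ι`, with collisions permitted in `S`,
topologized as a subspace of `X ^ ι`. -/
def Conf : Type (max u v) :=
  {x : ι → X // ∀ i j, x i = x j → i = j ∨ x i ∈ S}

instance : TopologicalSpace (Conf ι X S) :=
  inferInstanceAs (TopologicalSpace {x : ι → X // ∀ i j, x i = x j → i = j ∨ x i ∈ S})

/-- Two labelled configurations are equivalent if they differ by a permutation of the labels. -/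
def Conf.setoid : Setoid (Conf ι X S) where
  r x y := ∃ σ : Equiv.Perm ι, ∀ i, y.1 i = x.1 (σ i)
  iseqv :=
    { refl := fun _ => ⟨1, fun _ => rfl⟩
      symm := fun {x y} ⟨σ, h⟩ => ⟨σ⁻¹, fun i => by rw [h]; simp⟩
      trans := fun {x y z} ⟨σ, h⟩ ⟨τ, h'⟩ => ⟨σ * τ, fun i => by rw [h', h]; rfl⟩ }

/-- Unordered configurations: the quotient of `Conf ι X S` by the symmetric group of `ι`. -/
def UConf : Type (max u v) := Quotient (Conf.setoid ι X S)

instance : TopologicalSpace (UConf ι X S) :=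
  inferInstanceAs (TopologicalSpace (Quotient (Conf.setoid ι X S)))

/-- The unordered configuration space `B_k(X, S)`. -/
abbrev B (k : ℕ) (X : Type v) [TopologicalSpace X] (S : Set X) : Type v := UConf (Fin k) X S

variable {ι X S}

/-- The unordered configuration underlying an ordered one. -/
def UConf.mk (x : Conf ι X S) : UConf ι X S := Quotient.mk (Conf.setoid ι X S) x

theorem UConf.continuous_mk : Continuous (UConf.mk : Conf ι X S → UConf ι X S) :=
  continuous_quot_mk

theorem UConf.mk_eq_mk {x y : Conf ι X S} :
    UConf.mk x = UConf.mk y ↔ ∃ σ : Equiv.Perm ι, ∀ i, y.1 i = x.1 (σ i) :=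
  Quotient.eq (r := Conf.setoid ι X S)

theorem Conf.continuous_eval (i : ι) : Continuous fun x : Conf ι X S => x.1 i :=
  (continuous_apply i).comp continuous_subtype_val

theorem Conf.continuous_of_eval {Z : Type w} [TopologicalSpace Z] {f : Z → Conf ι X S}
    (h : ∀ i, Continuous fun z => (f z).1 i) : Continuous f :=
  continuous_induced_rng.2 (continuous_pi h)

/-- Change of labels along a bijection, for ordered configurations. -/
def Conf.reindex {κ : Type w} (e : κ ≃ ι) : C(Conf ι X S, Conf κ X S) where
  toFun x := ⟨fun i => x.1 (e i), fun _ _ h => (x.2 _ _ h).imp (fun h => e.injective h) id⟩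
  continuous_toFun := Conf.continuous_of_eval fun i => Conf.continuous_eval (e i)

theorem Conf.reindex_apply {κ : Type w} (e : κ ≃ ι) (x : Conf ι X S) (i : κ) :
    (Conf.reindex e x).1 i = x.1 (e i) := rfl

theorem UConf.isOpenQuotientMap_mk :
    IsOpenQuotientMap (UConf.mk : Conf ι X S → UConf ι X S) := by
  refine ⟨Quotient.mk_surjective, UConf.continuous_mk, fun U hU => ?_⟩
  have key : UConf.mk ⁻¹' (UConf.mk '' U) =
      ⋃ σ : Equiv.Perm ι, Conf.reindex (X := X) (S := S) σ ⁻¹' U := by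
    ext x
    simp only [mem_preimage, mem_image, mem_iUnion]
    constructor
    · rintro ⟨y, hy, h⟩
      obtain ⟨σ, hσ⟩ := UConf.mk_eq_mk.1 h.symm
      have e : Conf.reindex σ x = y := Subtype.ext (funext fun i => (hσ i).symm)
      exact ⟨σ, e ▸ hy⟩
    · rintro ⟨σ, h⟩
      exact ⟨_, h, UConf.mk_eq_mk.2 ⟨σ⁻¹, fun i => by simp [Conf.reindex_apply]⟩⟩
  change IsOpen (UConf.mk ⁻¹' (UConf.mk '' U))
  rw [key]
  exact isOpen_iUnion fun σ => hU.preimage (Conf.reindex σ).continuous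

/-- Near monomorphisms of pairs. -/
structure NearMono {Y : Type w} [TopologicalSpace Y] (f : C(X, Y)) (S : Set X) (T : Set Y) :
    Prop where
  mapsTo : MapsTo f S T
  injOn : InjOn f (f ⁻¹' Tᶜ)

theorem NearMono.of_injective {Y : Type w} [TopologicalSpace Y] {f : C(X, Y)}
    (hf : Function.Injective f) : NearMono f ∅ ∅ :=
  ⟨fun _ h => h.elim, hf.injOn⟩

/-- The map induced on ordered configuration spaces by a near monomorphism. -/
def Conf.map {Y : Type w} [TopologicalSpace Y] {T : Set Y} (f : C(X, Y)) (hf : NearMono f S T) :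
    C(Conf ι X S, Conf ι Y T) where
  toFun x := ⟨fun i => f (x.1 i), fun i j h => by
    by_cases hT : f (x.1 i) ∈ T
    · exact Or.inr hT
    · have h : f (x.1 i) = f (x.1 j) := h
      have hT' : f (x.1 j) ∉ T := h ▸ hT
      rcases x.2 i j (hf.injOn hT hT' h) with h' | h'
      · exact Or.inl h'
      · exact Or.inr (hf.mapsTo h')⟩
  continuous_toFun := Conf.continuous_of_eval fun i => f.continuous.comp (Conf.continuous_eval i)

/-- The map induced on unordered configuration spaces by a near monomorphism. -/
def UConf.map {Y : Type w} [TopologicalSpace Y] {T : Set Y} (f : C(X, Y)) (hf : NearMono f S T) :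
    C(UConf ι X S, UConf ι Y T) where
  toFun := Quotient.lift (fun x => UConf.mk (Conf.map f hf x)) fun _ _ ⟨σ, h⟩ =>
    UConf.mk_eq_mk.2 ⟨σ, fun i => congrArg f (h i)⟩
  continuous_toFun :=
    Continuous.quotient_lift (UConf.continuous_mk.comp (Conf.map f hf).continuous) _

/-- Change of labels along a bijection. -/
def UConf.reindex {κ : Type w} (e : κ ≃ ι) : C(UConf ι X S, UConf κ X S) where
  toFun := Quotient.lift (fun x => UConf.mk (Conf.reindex e x)) fun _ _ ⟨σ, h⟩ =>
    UConf.mk_eq_mk.2 ⟨(e.trans σ).trans e.symm, fun i => by simp [Conf.reindex_apply, h]⟩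
  continuous_toFun :=
    Continuous.quotient_lift (UConf.continuous_mk.comp (Conf.reindex e).continuous) _

end Configurations

section Amalgamation

variable {A : Type u} (L : A → Type z) {X : A → Type v} [∀ a, TopologicalSpace (X a)]
  {Y : Type w} [TopologicalSpace Y]

/-- Amalgamation of ordered configurations in spaces with disjoint embeddings into `Y`. -/
def Conf.amalgamate (f : ∀ a, C(X a, Y))
    (hf : ∀ a b x y, f a x = f b y → (⟨a, x⟩ : Σ a, X a) = ⟨b, y⟩) :
    C(∀ a, Conf (L a) (X a) ∅, Conf (Σ a, L a) Y ∅) where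
  toFun x := ⟨fun p => f p.1 ((x p.1).1 p.2), fun p q h => Or.inl <| by
    obtain ⟨a, i⟩ := p
    obtain ⟨b, j⟩ := q
    have h' := hf a b _ _ h
    obtain rfl : a = b := congrArg Sigma.fst h'
    have h'' := eq_of_heq (Sigma.mk.inj h').2
    rcases (x a).2 i j h'' with h3 | h3
    · rw [h3]
    · exact h3.elim⟩
  continuous_toFun := Conf.continuous_of_eval fun p => (f p.1).continuous.comp
    ((Conf.continuous_eval p.2).comp (continuous_apply p.1))

/-- Amalgamation of unordered configurations: given jointly injective maps `f a : X a → Y`, i.e. an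
injection from the disjoint union of the `X a` into `Y`, a family of configurations in the `X a`
is sent to the union of their images, a configuration in `Y`. -/
noncomputable def UConf.amalgamate [Finite A] (f : ∀ a, C(X a, Y))
    (hf : ∀ a b x y, f a x = f b y → (⟨a, x⟩ : Σ a, X a) = ⟨b, y⟩) :
    C(∀ a, UConf (L a) (X a) ∅, UConf (Σ a, L a) Y ∅) :=
  Topology.IsQuotientMap.lift
    (f := ⟨Pi.map fun a => (UConf.mk : Conf (L a) (X a) ∅ → UConf (L a) (X a) ∅),
      Continuous.piMap fun _ => UConf.continuous_mk⟩)
    (IsOpenQuotientMap.piMap fun _ => UConf.isOpenQuotientMap_mk).isQuotientMap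
    (ContinuousMap.comp ⟨UConf.mk, UConf.continuous_mk⟩ (Conf.amalgamate L f hf))
    (fun x y h => by
      have h' : ∀ a, ∃ σ : Equiv.Perm (L a), ∀ i, (y a).1 i = (x a).1 (σ i) := fun a =>
        UConf.mk_eq_mk.1 (congrFun h a)
      choose σ hσ using h'
      exact UConf.mk_eq_mk.2 ⟨Equiv.sigmaCongrRight σ, fun p => congrArg (f p.1) (hσ p.1 p.2)⟩)

end Amalgamation


/-- A graph, presented by its vertices and its parametrized edges. When `V` and `E` are finite,
this is exactly the data of a finite CW complex of dimension at most one; self-loops, multiple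
edges and isolated vertices are permitted. -/
structure CellGraph (V : Type u) (E : Type v) where
  src : E → V
  tgt : E → V

namespace CellGraph

section Realization

variable {V : Type u} {E : Type v} (Γ : CellGraph V E)

/-- The points of the CW complex: the disjoint union of its open cells. -/
inductive Space {V : Type u} {E : Type v} (Γ : CellGraph V E) : Type (max u v)
  | vertex (x : V) : Space Γ
  | cell (e : E) (t : Ioo (0 : ℝ) 1) : Space Γ

variable {Γ} in
theorem Space.vertex_injective : Function.Injective (Space.vertex : V → Γ.Space) := fun _ _ h => by
  cases h; rfl

variable {Γ} in
theorem Space.cell_inj {e e' : E} {t t' : Ioo (0 : ℝ) 1}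
    (h : (Space.cell e t : Γ.Space) = Space.cell e' t') : e = e' ∧ (t : ℝ) = t' := by
  cases h; exact ⟨rfl, rfl⟩

open Classical in
/-- The characteristic map of the closed edge `e`. -/
noncomputable def edgePt (e : E) (t : unitInterval) : Γ.Space :=
  if h0 : t = 0 then .vertex (Γ.src e)
  else if h1 : t = 1 then .vertex (Γ.tgt e)
  else .cell e ⟨t, unitInterval.pos_iff_ne_zero.2 h0, unitInterval.lt_one_iff_ne_one.2 h1⟩

/-- The weak topology: a set is open if its preimage in each closed edge is so. -/
noncomputable instance : TopologicalSpace Γ.Space :=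
  ⨆ e : E, TopologicalSpace.coinduced (Γ.edgePt e) inferInstance

theorem isOpen_iff {U : Set Γ.Space} : IsOpen U ↔ ∀ e, IsOpen (Γ.edgePt e ⁻¹' U) := by
  rw [isOpen_iSup_iff]; rfl

theorem continuous_edgePt (e : E) : Continuous (Γ.edgePt e) :=
  continuous_def.2 fun _ hU => Γ.isOpen_iff.1 hU e

theorem edgePt_zero (e : E) : Γ.edgePt e 0 = .vertex (Γ.src e) := by simp [edgePt]

theorem edgePt_one (e : E) : Γ.edgePt e 1 = .vertex (Γ.tgt e) := by simp [edgePt]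

/-- The interior points of the unit interval, as points of the closed interval. -/
noncomputable def toI (t : Ioo (0 : ℝ) 1) : unitInterval := ⟨t, t.2.1.le, t.2.2.le⟩

theorem toI_ne_zero (t : Ioo (0 : ℝ) 1) : toI t ≠ 0 := fun h => t.2.1.ne' (congrArg Subtype.val h)

theorem toI_ne_one (t : Ioo (0 : ℝ) 1) : toI t ≠ 1 := fun h => t.2.2.ne (congrArg Subtype.val h)

theorem edgePt_toI (e : E) (t : Ioo (0 : ℝ) 1) : Γ.edgePt e (toI t) = .cell e t := by
  simp only [edgePt, dif_neg (toI_ne_zero t), dif_neg (toI_ne_one t)]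
  rfl

theorem exists_toI {t : unitInterval} (h0 : t ≠ 0) (h1 : t ≠ 1) : ∃ s, toI s = t :=
  ⟨⟨t, unitInterval.pos_iff_ne_zero.2 h0, unitInterval.lt_one_iff_ne_one.2 h1⟩, rfl⟩

/-- A continuous map out of a graph, specified on vertices and on closed edges. -/
noncomputable def lift {Y : Type w} [TopologicalSpace Y] (f : V → Y) (g : E → C(unitInterval, Y))
    (h0 : ∀ e, g e 0 = f (Γ.src e)) (h1 : ∀ e, g e 1 = f (Γ.tgt e)) : C(Γ.Space, Y) where
  toFun
    | .vertex x => f x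
    | .cell e t => g e (toI t)
  continuous_toFun := by
    refine continuous_iSup_dom.2 fun e => continuous_coinduced_dom.2 ?_
    convert (g e).continuous using 1
    funext t
    by_cases ht0 : t = 0
    · subst ht0; simp [edgePt_zero, h0]
    by_cases ht1 : t = 1
    · subst ht1; simp [edgePt_one, h1]
    obtain ⟨s, rfl⟩ := exists_toI ht0 ht1
    simp [edgePt_toI]

/-- The edges at the vertex `x`. -/
def Incident (x : V) : Type v := {e : E // Γ.src e = x ∨ Γ.tgt e = x}

/-- The valence of a vertex: the number of ends of edges at it. -/
noncomputable def valence (x : V) : ℕ :=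
  Nat.card {e : E // Γ.src e = x} + Nat.card {e : E // Γ.tgt e = x}

/-- A vertex is essential if its valence is at least three. -/
def Essential (x : V) : Prop := 3 ≤ Γ.valence x

/-- Adjacency of vertices. -/
def Adj (x y : V) : Prop :=
  ∃ e, (Γ.src e = x ∧ Γ.tgt e = y) ∨ (Γ.src e = y ∧ Γ.tgt e = x)

/-- A vertex is separating if its complement is disconnected. -/
def Separating (x : V) : Prop := ¬ IsPreconnected ({.vertex x}ᶜ : Set Γ.Space)

/-- The closed star of a vertex: the union of the vertex and of the closed edges at it. -/
def closedStar (x : V) : Set Γ.Space :=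
  {.vertex x} ∪ ⋃ e : Γ.Incident x, range (Γ.edgePt e.1)

/-- The conditions that are imposed on a graph by subdividing it: there are no self-loops and no
multiple edges, vertices adjacent to essential vertices are bivalent, and distinct essential
vertices have disjoint closed stars. -/
structure Subdivided : Prop where
  loopless : ∀ e, Γ.src e ≠ Γ.tgt e
  simple : ∀ e e', s(Γ.src e, Γ.tgt e) = s(Γ.src e', Γ.tgt e') → e = e'
  bivalent : ∀ x y, Γ.Essential x → Γ.Adj x y → Γ.valence y = 2
  disjoint_stars : ∀ x y, Γ.Essential x → Γ.Essential y → x ≠ y →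
    Disjoint (Γ.closedStar x) (Γ.closedStar y)

/-- The connected component of the point `p` in the complement of the vertex `x`. -/
def complComponent (x : V) (p : Γ.Space) : Set Γ.Space := connectedComponentIn {.vertex x}ᶜ p

/-- The midpoint of an edge. -/
noncomputable def midpoint (e : E) : Γ.Space := .cell e ⟨1 / 2, by norm_num, by norm_num⟩

/-- Two edges at `x` are equivalent if they lie in the same component of the complement of `x`. -/
def edgeSetoid (x : V) : Setoid (Γ.Incident x) :=
  Setoid.ker fun e => Γ.complComponent x (Γ.midpoint e.1)

theorem complComponent_eq {x : V} {e : E} {J : Set unitInterval} (hJ : IsPreconnected J)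
    (hx : ∀ t ∈ J, Γ.edgePt e t ≠ .vertex x) {s t : unitInterval} (hs : s ∈ J) (ht : t ∈ J) :
    Γ.complComponent x (Γ.edgePt e s) = Γ.complComponent x (Γ.edgePt e t) := by
  refine connectedComponentIn_eq ?_
  refine (hJ.image _ (Γ.continuous_edgePt e).continuousOn).subset_connectedComponentIn
    (mem_image_of_mem _ hs) ?_ (mem_image_of_mem _ ht)
  rintro _ ⟨r, hr, rfl⟩
  exact hx r hr

theorem edgePt_ne_vertex {x : V} {e : E} {t : unitInterval} (h0 : t = 0 → Γ.src e ≠ x)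
    (h1 : t = 1 → Γ.tgt e ≠ x) : Γ.edgePt e t ≠ .vertex x := by
  intro h
  by_cases ht0 : t = 0
  · subst ht0; rw [edgePt_zero] at h; exact h0 rfl (Space.vertex_injective h)
  by_cases ht1 : t = 1
  · subst ht1; rw [edgePt_one] at h; exact h1 rfl (Space.vertex_injective h)
  obtain ⟨s, rfl⟩ := exists_toI ht0 ht1
  rw [edgePt_toI] at h
  cases h

theorem complComponent_midpoint {x : V} {e : E} {t : unitInterval}
    (h0 : t = 0 → Γ.src e ≠ x) (h1 : t = 1 → Γ.tgt e ≠ x) :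
    Γ.complComponent x (Γ.edgePt e t) = Γ.complComponent x (Γ.midpoint e) := by
  have hm : Γ.midpoint e = Γ.edgePt e (toI ⟨1 / 2, by norm_num, by norm_num⟩) :=
    (Γ.edgePt_toI _ _).symm
  rw [hm]
  refine Γ.complComponent_eq (J := uIcc t (toI ⟨1 / 2, by norm_num, by norm_num⟩))
    isPreconnected_uIcc (fun s hs => Γ.edgePt_ne_vertex ?_ ?_) left_mem_uIcc right_mem_uIcc
  · rintro rfl
    apply h0
    rcases mem_uIcc.1 hs with h | h
    · exact le_antisymm h.1 unitInterval.nonneg'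
    · exact absurd (le_antisymm h.1 unitInterval.nonneg') (toI_ne_zero _)
  · rintro rfl
    apply h1
    rcases mem_uIcc.1 hs with h | h
    · exact absurd (le_antisymm unitInterval.le_one' h.2) (toI_ne_one _)
    · exact le_antisymm unitInterval.le_one' h.2

/-- In a connected graph, every component of the complement of `x` contains an edge at `x`. -/
theorem exists_incident [ConnectedSpace Γ.Space] {x : V} {p : Γ.Space} (hp : p ≠ .vertex x) :
    ∃ e : Γ.Incident x, Γ.complComponent x (Γ.midpoint e.1) = Γ.complComponent x p := by
  by_contra! hne
  set C := Γ.complComponent x p with hC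
  have hpC : p ∈ C := mem_connectedComponentIn hp
  have hxC : Space.vertex x ∉ C := fun h => connectedComponentIn_subset _ _ h rfl
  have hmem : ∀ q, q ≠ .vertex x → (q ∈ C ↔ Γ.complComponent x q = C) := fun q hq =>
    ⟨fun h => (connectedComponentIn_eq h).symm, fun h => h ▸ mem_connectedComponentIn hq⟩
  have key : ∀ e, Γ.edgePt e ⁻¹' C = ∅ ∨ Γ.edgePt e ⁻¹' C = univ := by
    intro e
    by_cases hi : Γ.src e = x ∨ Γ.tgt e = x
    · left
      refine eq_empty_iff_forall_notMem.2 fun t ht => ?_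
      have hv : Γ.edgePt e t ≠ .vertex x := fun h => hxC (h ▸ ht)
      refine hne ⟨e, hi⟩ ?_
      rw [← (hmem _ hv).1 ht]
      refine (Γ.complComponent_midpoint ?_ ?_).symm
      · rintro rfl h; exact hv (by rw [edgePt_zero, h])
      · rintro rfl h; exact hv (by rw [edgePt_one, h])
    · push Not at hi
      have hm : ∀ t, t ∈ Γ.edgePt e ⁻¹' C ↔ Γ.complComponent x (Γ.midpoint e) = C := fun t => by
        rw [mem_preimage, hmem _ (Γ.edgePt_ne_vertex (fun _ => hi.1) (fun _ => hi.2)),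
          Γ.complComponent_midpoint (fun _ => hi.1) (fun _ => hi.2)]
      by_cases h : Γ.complComponent x (Γ.midpoint e) = C
      · right; exact eq_univ_of_forall fun t => (hm t).2 h
      · left; exact eq_empty_iff_forall_notMem.2 fun t ht => h ((hm t).1 ht)
  have hclopen : IsClopen C := by
    constructor
    · rw [← isOpen_compl_iff, isOpen_iff]
      intro e
      rw [preimage_compl]
      rcases key e with h | h <;> simp [h]
    · rw [isOpen_iff]
      intro e
      rcases key e with h | h <;> simp [h]
  rcases isClopen_iff.1 hclopen with h | h
  · rw [h] at hpC; exact hpC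
  · rw [h] at hxC; exact hxC trivial

end Realization

section LocalGraphs

/-- The local graph of an equivalence relation on `I`: a central vertex `none`, one further vertex
for each class, and one edge for each `i`, from the central vertex to the vertex of its class. -/
def localGraph {I : Type u} (r : Setoid I) : CellGraph (Option (Quotient r)) I where
  src _ := none
  tgt i := some (Quotient.mk r i)

/-- The sinks of a local graph: all vertices except for the central one. -/
def localSinks {I : Type u} (r : Setoid I) : Set (localGraph r).Space :=
  {p | ∃ c, p = .vertex (some c)}

/-- The star graph, with central vertex `none` and one leaf for each `i`. -/
def star (I : Type u) : CellGraph (Option I) I where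
  src _ := none
  tgt i := some i

variable {V : Type u} {E : Type v} (Γ : CellGraph V E)

/-- The characteristic map of a closed edge, as a continuous map. -/
noncomputable def edgeMap (e : E) : C(unitInterval, Γ.Space) := ⟨Γ.edgePt e, Γ.continuous_edgePt e⟩

/-- The closed edge `e`, parametrized so as to start at the vertex `x`, where `e` is an edge
at `x`. -/
noncomputable def outward (x : V) (e : Γ.Incident x) : C(unitInterval, Γ.Space) :=
  open Classical in
  if Γ.src e.1 = x then Γ.edgeMap e.1
  else (Γ.edgeMap e.1).comp ⟨unitInterval.symm, unitInterval.continuous_symm⟩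

theorem outward_zero (x : V) (e : Γ.Incident x) : Γ.outward x e 0 = .vertex x := by
  unfold outward
  split_ifs with h
  · simp [edgeMap, edgePt_zero, h]
  · simp [edgeMap, edgePt_one, e.2.resolve_left h]

/-- The local graph at the vertex `x`. -/
abbrev localGraphAt (x : V) : CellGraph (Option (Quotient (Γ.edgeSetoid x))) (Γ.Incident x) :=
  localGraph (Γ.edgeSetoid x)

/-- The class of edges at `x` lying in the component of `p` in the complement of `x`. -/
noncomputable def componentClass [ConnectedSpace Γ.Space] (x : V) (p : Γ.Space)
    (hp : p ≠ .vertex x) : Quotient (Γ.edgeSetoid x) :=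
  Quotient.mk _ (Γ.exists_incident hp).choose

theorem componentClass_eq [ConnectedSpace Γ.Space] {x : V} {p : Γ.Space} (hp : p ≠ .vertex x)
    {e : Γ.Incident x} (h : Γ.complComponent x (Γ.midpoint e.1) = Γ.complComponent x p) :
    Γ.componentClass x p hp = Quotient.mk _ e :=
  Quotient.sound (s := Γ.edgeSetoid x) ((Γ.exists_incident hp).choose_spec.trans h.symm)

theorem componentClass_congr [ConnectedSpace Γ.Space] {x : V} {p q : Γ.Space}
    (hp : p ≠ .vertex x) (hq : q ≠ .vertex x)
    (h : Γ.complComponent x p = Γ.complComponent x q) :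
    Γ.componentClass x p hp = Γ.componentClass x q hq :=
  Γ.componentClass_eq hp ((Γ.exists_incident hq).choose_spec.trans h.symm)

theorem midpoint_ne_vertex (x : V) (e : E) : Γ.midpoint e ≠ .vertex x := by
  intro h; cases h

open Classical in
/-- The quotient map from a connected graph without self-loops to the local graph at `x`, on
vertices. -/
noncomputable def localQuotientVertex [ConnectedSpace Γ.Space] (x y : V) :
    (Γ.localGraphAt x).Space :=
  if h : y = x then .vertex none
  else .vertex (some (Γ.componentClass x (.vertex y) fun h' => h (Space.vertex_injective h')))

open Classical in
/-- The quotient map from a connected graph without self-loops to the local graph at `x`, on closed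
edges. -/
noncomputable def localQuotientEdge [ConnectedSpace Γ.Space] (x : V) (e : E) :
    C(unitInterval, (Γ.localGraphAt x).Space) :=
  if hs : Γ.src e = x then (Γ.localGraphAt x).edgeMap ⟨e, Or.inl hs⟩
  else if ht : Γ.tgt e = x then ((Γ.localGraphAt x).edgeMap ⟨e, Or.inr ht⟩).comp
    ⟨unitInterval.symm, unitInterval.continuous_symm⟩
  else ContinuousMap.const _
    (.vertex (some (Γ.componentClass x (Γ.midpoint e) (Γ.midpoint_ne_vertex x e))))

/-- The quotient map `q_x` from a connected graph without self-loops to the local graph at the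
vertex `x`. The open star of `x` is mapped identically, and any other point is mapped to the sink
indexed by its component in the complement of `x`. -/
noncomputable def localQuotient [ConnectedSpace Γ.Space] (hl : ∀ e, Γ.src e ≠ Γ.tgt e) (x : V) :
    C(Γ.Space, (Γ.localGraphAt x).Space) :=
  Γ.lift (Γ.localQuotientVertex x) (Γ.localQuotientEdge x)
    (fun e => by
      unfold localQuotientVertex localQuotientEdge
      split_ifs with h1 h2
      · exact edgePt_zero _ _
      · have hc := Γ.complComponent_midpoint (x := x) (e := e) (t := 0) (fun _ => h1)
          (fun h => absurd h zero_ne_one)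
        rw [edgePt_zero] at hc
        refine Eq.trans ?_ (congrArg _ (congrArg _ (Γ.componentClass_eq (e := ⟨e, Or.inr h2⟩) _
          hc.symm).symm))
        simp only [edgeMap, ContinuousMap.comp_apply, ContinuousMap.coe_mk, unitInterval.symm_zero]
        exact edgePt_one _ _
      · have hc := Γ.complComponent_midpoint (x := x) (e := e) (t := 0) (fun _ => h1)
          (fun h => absurd h zero_ne_one)
        rw [edgePt_zero] at hc
        exact congrArg _ (congrArg _ (Γ.componentClass_congr _ _ hc.symm)))
    (fun e => by
      unfold localQuotientVertex localQuotientEdge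
      split_ifs with h1 h2 h2
      · exact absurd (h1.trans h2.symm) (hl e)
      · have hc := Γ.complComponent_midpoint (x := x) (e := e) (t := 1)
          (fun h => absurd h one_ne_zero) (fun _ => h2)
        rw [edgePt_one] at hc
        refine Eq.trans ?_ (congrArg _ (congrArg _ (Γ.componentClass_eq (e := ⟨e, Or.inl h1⟩) _
          hc.symm).symm))
        exact edgePt_one _ _
      · simp only [edgeMap, ContinuousMap.comp_apply, ContinuousMap.coe_mk, unitInterval.symm_one]
        exact edgePt_zero _ _
      · have hc := Γ.complComponent_midpoint (x := x) (e := e) (t := 1)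
          (fun h => absurd h one_ne_zero) (fun _ => h2)
        rw [edgePt_one] at hc
        exact congrArg _ (congrArg _ (Γ.componentClass_congr _ _ hc.symm)))

theorem symm_toI (t : Ioo (0 : ℝ) 1) :
    unitInterval.symm (toI t) = toI ⟨1 - t, by linarith [t.2.2], by linarith [t.2.1]⟩ := rfl

theorem nearMono_localQuotient [ConnectedSpace Γ.Space] (hl : ∀ e, Γ.src e ≠ Γ.tgt e) (x : V) :
    NearMono (Γ.localQuotient hl x) ∅ (localSinks (Γ.edgeSetoid x)) := by
  refine ⟨fun _ h => h.elim, ?_⟩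
  have hv : ∀ y, Γ.localQuotient hl x (.vertex y) = Γ.localQuotientVertex x y := fun _ => rfl
  have he : ∀ e t, Γ.localQuotient hl x (.cell e t) = Γ.localQuotientEdge x e (toI t) :=
    fun _ _ => rfl
  have hv' : ∀ y, Γ.localQuotient hl x (.vertex y) ∉ localSinks (Γ.edgeSetoid x) →
      y = x ∧ Γ.localQuotient hl x (.vertex y) = .vertex none := by
    intro y h
    rw [hv] at h ⊢
    unfold localQuotientVertex at h ⊢
    split_ifs at h ⊢ with h1
    · exact ⟨h1, rfl⟩
    · exact absurd ⟨_, rfl⟩ h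
  have he' : ∀ e t, Γ.localQuotient hl x (.cell e t) ∉ localSinks (Γ.edgeSetoid x) →
      (∃ h, Γ.src e = x ∧ Γ.localQuotient hl x (.cell e t) = .cell ⟨e, h⟩ t) ∨
      (∃ h, Γ.src e ≠ x ∧ Γ.localQuotient hl x (.cell e t) =
        .cell ⟨e, h⟩ ⟨1 - t, by linarith [t.2.2], by linarith [t.2.1]⟩) := by
    intro e t h
    rw [he] at h ⊢
    unfold localQuotientEdge at h ⊢
    split_ifs at h ⊢ with h1 h2
    · exact Or.inl ⟨Or.inl h1, h1, edgePt_toI _ _ _⟩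
    · refine Or.inr ⟨Or.inr h2, h1, ?_⟩
      simp only [edgeMap, ContinuousMap.comp_apply, ContinuousMap.coe_mk, symm_toI]
      exact edgePt_toI _ _ _
    · exact absurd ⟨_, rfl⟩ h
  rintro (y | ⟨e, t⟩) hp (z | ⟨e', t'⟩) hq heq
  · rw [(hv' y hp).1, (hv' z hq).1]
  · rw [(hv' y hp).2] at heq
    rcases he' e' t' hq with ⟨_, _, h⟩ | ⟨_, _, h⟩ <;> rw [h] at heq <;> cases heq
  · rw [(hv' z hq).2] at heq
    rcases he' e t hp with ⟨_, _, h⟩ | ⟨_, _, h⟩ <;> rw [h] at heq <;> cases heq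
  · rcases he' e t hp with ⟨_, hs, h⟩ | ⟨_, hs, h⟩ <;>
      rcases he' e' t' hq with ⟨_, hs', h'⟩ | ⟨_, hs', h'⟩ <;>
      rw [h, h'] at heq <;> obtain ⟨h1, h2⟩ := Space.cell_inj heq <;>
      replace h1 := congrArg Subtype.val h1 <;> simp only at h1 h2
    · rw [h1, Subtype.ext h2]
    · exact absurd (h1 ▸ hs) hs'
    · exact absurd (h1 ▸ hs') hs
    · have : t = t' := Subtype.ext (by linarith)
      rw [h1, this]

/-- The embedding of the star graph on `I` onto the closed star of `x` determined by an indexing of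
the edges at `x` by `I`, linear on each edge. -/
noncomputable def starMap (x : V) {I : Type w} (o : I → Γ.Incident x) :
    C((star I).Space, Γ.Space) :=
  (star I).lift (fun i => i.elim (.vertex x) fun i => Γ.outward x (o i) 1)
    (fun i => Γ.outward x (o i)) (fun i => Γ.outward_zero x (o i)) (fun _ => rfl)

theorem outward_mem_closedStar (x : V) (e : Γ.Incident x) (t : unitInterval) :
    Γ.outward x e t ∈ Γ.closedStar x := by
  refine Or.inr (mem_iUnion.2 ⟨e, ?_⟩)
  unfold outward
  split_ifs
  · exact ⟨t, rfl⟩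
  · exact ⟨unitInterval.symm t, rfl⟩

theorem starMap_mem_closedStar (x : V) {I : Type w} (o : I → Γ.Incident x)
    (p : (star I).Space) : Γ.starMap x o p ∈ Γ.closedStar x := by
  rcases p with (_ | i) | ⟨i, t⟩
  · exact Or.inl rfl
  · exact Γ.outward_mem_closedStar _ _ _
  · exact Γ.outward_mem_closedStar _ _ _

/-- The end other than `x` of an edge at `x`. -/
theorem exists_outward_one (x : V) (hl : ∀ e, Γ.src e ≠ Γ.tgt e) (e : Γ.Incident x) :
    ∃ y, y ≠ x ∧ s(Γ.src e.1, Γ.tgt e.1) = s(x, y) ∧ Γ.outward x e 1 = .vertex y := by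
  unfold outward
  split_ifs with h
  · exact ⟨_, fun h' => hl e.1 (h.trans h'.symm), by rw [h], edgePt_one _ _⟩
  · refine ⟨_, h, ?_, ?_⟩
    · rw [e.2.resolve_left h, Sym2.eq_swap]
    · simp only [edgeMap, ContinuousMap.comp_apply, ContinuousMap.coe_mk, unitInterval.symm_one]
      exact edgePt_zero _ _

theorem exists_outward_toI (x : V) (e : Γ.Incident x) :
    (∀ t, Γ.outward x e (toI t) = .cell e.1 t) ∨
    (∀ t, Γ.outward x e (toI t) =
      .cell e.1 ⟨1 - t, by linarith [t.2.2], by linarith [t.2.1]⟩) := by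
  unfold outward
  split_ifs with h
  · exact Or.inl fun t => edgePt_toI _ _ _
  · refine Or.inr fun t => ?_
    simp only [edgeMap, ContinuousMap.comp_apply, ContinuousMap.coe_mk, symm_toI]
    exact edgePt_toI _ _ _

theorem starMap_injective (x : V) (hl : ∀ e, Γ.src e ≠ Γ.tgt e)
    (hs : ∀ e e', s(Γ.src e, Γ.tgt e) = s(Γ.src e', Γ.tgt e') → e = e') {I : Type w}
    {o : I → Γ.Incident x} (ho : Function.Injective o) :
    Function.Injective (Γ.starMap x o) := by
  have hc : Γ.starMap x o (.vertex none) = .vertex x := rfl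
  have hi : ∀ i, Γ.starMap x o (.vertex (some i)) = Γ.outward x (o i) 1 := fun _ => rfl
  have he : ∀ i t, Γ.starMap x o (.cell i t) = Γ.outward x (o i) (toI t) := fun _ _ => rfl
  have hcell : ∀ i t, ∃ s, Γ.starMap x o (.cell i t) = .cell (o i).1 s := by
    intro i t
    rw [he]
    rcases Γ.exists_outward_toI x (o i) with h | h
    · exact ⟨_, h t⟩
    · exact ⟨_, h t⟩
  have hvert : ∀ j, ∃ y, Γ.starMap x o (.vertex j) = .vertex y := by
    rintro (_ | i)
    · exact ⟨_, hc⟩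
    · obtain ⟨y, _, _, h⟩ := Γ.exists_outward_one x hl (o i)
      exact ⟨y, h⟩
  rintro (j | ⟨i, t⟩) (j' | ⟨i', t'⟩) heq
  · congr 1
    rcases j with _ | i <;> rcases j' with _ | i'
    · rfl
    · obtain ⟨y, hy, _, h⟩ := Γ.exists_outward_one x hl (o i')
      rw [hc, hi, h] at heq
      exact absurd (Space.vertex_injective heq).symm hy
    · obtain ⟨y, hy, _, h⟩ := Γ.exists_outward_one x hl (o i)
      rw [hc, hi, h] at heq
      exact absurd (Space.vertex_injective heq) hy
    · obtain ⟨y, _, h1, h⟩ := Γ.exists_outward_one x hl (o i)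
      obtain ⟨y', _, h1', h'⟩ := Γ.exists_outward_one x hl (o i')
      rw [hi, hi, h, h'] at heq
      rw [Space.vertex_injective heq, ← h1'] at h1
      rw [ho (Subtype.ext (hs _ _ h1))]
  · obtain ⟨y, hy⟩ := hvert j
    obtain ⟨s, hs⟩ := hcell i' t'
    rw [hy, hs] at heq
    cases heq
  · obtain ⟨y, hy⟩ := hvert j'
    obtain ⟨s, hs⟩ := hcell i t
    rw [hy, hs] at heq
    cases heq
  · obtain ⟨s, h1⟩ := hcell i t
    obtain ⟨s', h1'⟩ := hcell i' t'
    have h2 := heq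
    rw [h1, h1'] at h2
    obtain rfl := ho (Subtype.ext (Space.cell_inj h2).1)
    rw [he, he] at heq
    rcases Γ.exists_outward_toI x (o i) with h | h
    · rw [h, h] at heq
      rw [Subtype.ext (Space.cell_inj heq).2]
    · rw [h, h] at heq
      have h3 := (Space.cell_inj heq).2
      simp only at h3
      have : t = t' := Subtype.ext (by linarith)
      rw [this]

end LocalGraphs

section EdgeStabilization

variable {I : Type u} (e : I)

open Classical in
/-- The coordinate of a point of the star graph along the `e`th closed edge, measured from the
central vertex; it vanishes at points not on this edge. -/
noncomputable def coord : C((star I).Space, unitInterval) :=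
  (star I).lift (fun j => if j = some e then 1 else 0)
    (fun i => if i = e then ContinuousMap.id _ else ContinuousMap.const _ 0)
    (fun i => by dsimp only [star]; split_ifs with h1 h2 <;> simp_all)
    (fun i => by dsimp only [star]; split_ifs with h1 h2 <;> simp_all)

open Classical in
theorem coord_vertex (j : Option I) :
    coord e (.vertex j) = if j = some e then 1 else 0 := rfl

open Classical in
theorem coord_cell (i : I) (t : Ioo (0 : ℝ) 1) :
    coord e (.cell i t) = if i = e then toI t else 0 := by
  change (if i = e then ContinuousMap.id unitInterval else ContinuousMap.const _ 0) (toI t) = _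
  split_ifs <;> rfl

theorem star_edgePt_zero (i : I) : (star I).edgePt i 0 = .vertex none := edgePt_zero _ _

theorem star_edgePt_one (i : I) : (star I).edgePt i 1 = .vertex (some i) := edgePt_one _ _

theorem coord_edgePt (t : unitInterval) : coord e ((star I).edgePt e t) = t := by
  by_cases h0 : t = 0
  · subst h0; rw [star_edgePt_zero]; simp [coord_vertex]
  by_cases h1 : t = 1
  · subst h1; rw [star_edgePt_one]; simp [coord_vertex]
  obtain ⟨s, rfl⟩ := exists_toI h0 h1
  rw [edgePt_toI]; simp [coord_cell]

theorem coord_edgePt_of_ne {i : I} (hi : i ≠ e) (t : unitInterval) :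
    coord i ((star I).edgePt e t) = 0 := by
  by_cases h0 : t = 0
  · subst h0; rw [star_edgePt_zero]; simp [coord_vertex]
  by_cases h1 : t = 1
  · subst h1; rw [star_edgePt_one]; simp [coord_vertex, hi.symm]
  obtain ⟨s, rfl⟩ := exists_toI h0 h1
  rw [edgePt_toI]; simp [coord_cell, hi.symm]

theorem edgePt_coord {p : (star I).Space} (h : coord e p ≠ 0) :
    (star I).edgePt e (coord e p) = p := by
  rcases p with j | ⟨i, t⟩
  · by_cases hj : j = some e
    · subst hj
      rw [coord_vertex, if_pos rfl, star_edgePt_one]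
    · exact absurd (by rw [coord_vertex, if_neg hj]) h
  · by_cases hi : i = e
    · subst hi
      rw [coord_cell, if_pos rfl, edgePt_toI]
    · exact absurd (by rw [coord_cell, if_neg hi]) h

/-- The average of two points of the unit interval. -/
noncomputable def avg (s t : unitInterval) : unitInterval :=
  ⟨((s : ℝ) + t) / 2, by have := s.2.1; have := t.2.1; linarith,
    by have := s.2.2; have := t.2.2; linarith⟩

theorem continuous_avg {Z : Type w} [TopologicalSpace Z] {f g : Z → unitInterval}
    (hf : Continuous f) (hg : Continuous g) : Continuous fun z => avg (f z) (g z) :=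
  Continuous.subtype_mk (((continuous_subtype_val.comp hf).add
    (continuous_subtype_val.comp hg)).div_const 2) _

variable {ι : Type w} [Fintype ι]

open Classical in
/-- The coordinate of the last particle on the `e`th edge preceding the `j`th, or `0` if there is
no such particle. -/
noncomputable def predCoord (x : ι → (star I).Space) (j : ι) : unitInterval :=
  Finset.univ.sup fun i => if coord e (x i) < coord e (x j) then coord e (x i) else 0

/-- The coordinate of the last particle on the `e`th edge, or `0` if there is no such particle. -/
noncomputable def lastCoord (x : ι → (star I).Space) : unitInterval :=
  Finset.univ.sup fun i => coord e (x i)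

open Classical in
/-- Edge stabilization of labelled configurations: the particles `x_1 < ⋯ < x_l` on the `e`th
closed edge are replaced by the averages of consecutive terms of `0, x_1, …, x_l, 1`. The average
of `x_j` and its predecessor carries the label of `x_j`, and that of `x_l` and `1` the new label. -/
noncomputable def stabTuple (x : ι → (star I).Space) : Option ι → (star I).Space
  | none => (star I).edgePt e (avg (lastCoord e x) 1)
  | some j => if x j ∈ range ((star I).edgePt e) then
      (star I).edgePt e (avg (predCoord e x j) (coord e (x j))) else x j

theorem predCoord_le (x : ι → (star I).Space) (j : ι) : predCoord e x j ≤ coord e (x j) := by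
  refine Finset.sup_le fun i _ => ?_
  split_ifs with h
  · exact h.le
  · exact unitInterval.nonneg'

theorem le_predCoord (x : ι → (star I).Space) {i j : ι} (h : coord e (x i) < coord e (x j)) :
    coord e (x i) ≤ predCoord e x j := by
  classical
  have := Finset.le_sup (f := fun i => if coord e (x i) < coord e (x j) then coord e (x i) else 0)
    (Finset.mem_univ i)
  rw [if_pos h] at this
  unfold predCoord
  convert this

theorem predCoord_lt_one (x : ι → (star I).Space) (j : ι) : predCoord e x j < 1 := by
  refine (Finset.sup_lt_iff (by exact zero_lt_one)).2 fun i _ => ?_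
  split_ifs with h
  · exact h.trans_le unitInterval.le_one'
  · exact zero_lt_one

theorem avg_lt {x : ι → (star I).Space} {i j : ι} (h : coord e (x i) < coord e (x j)) :
    avg (predCoord e x i) (coord e (x i)) < avg (predCoord e x j) (coord e (x j)) := by
  have h1 : (predCoord e x i : ℝ) ≤ coord e (x i) := predCoord_le e x i
  have h2 : (coord e (x i) : ℝ) ≤ predCoord e x j := le_predCoord e x h
  have h3 : (coord e (x i) : ℝ) < coord e (x j) := h
  change ((predCoord e x i : ℝ) + coord e (x i)) / 2 < ((predCoord e x j : ℝ) + coord e (x j)) / 2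
  linarith

theorem avg_lt_last (x : ι → (star I).Space) (j : ι) :
    avg (predCoord e x j) (coord e (x j)) < avg (lastCoord e x) 1 := by
  have h1 : (predCoord e x j : ℝ) < 1 := predCoord_lt_one e x j
  have h2 : coord e (x j) ≤ lastCoord e x :=
    Finset.le_sup (f := fun i => coord e (x i)) (Finset.mem_univ j)
  have h2 : (coord e (x j) : ℝ) ≤ lastCoord e x := h2
  change ((predCoord e x j : ℝ) + coord e (x j)) / 2 < ((lastCoord e x : ℝ) + (1 : ℝ)) / 2
  linarith

theorem stabTuple_injective {x : ι → (star I).Space} (hx : Function.Injective x) :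
    Function.Injective (stabTuple e x) := by
  have hinj : Function.Injective ((star I).edgePt e) :=
    Function.LeftInverse.injective (coord_edgePt e)
  rintro (_ | i) (_ | j) h
  · rfl
  · simp only [stabTuple] at h
    split_ifs at h with hj
    · exact absurd (hinj h) (avg_lt_last e x j).ne'
    · exact absurd ⟨_, h⟩ hj
  · simp only [stabTuple] at h
    split_ifs at h with hi
    · exact absurd (hinj h) (avg_lt_last e x i).ne
    · exact absurd ⟨_, h.symm⟩ hi
  · simp only [stabTuple] at h
    split_ifs at h with hi hj hj
    · rcases lt_trichotomy (coord e (x i)) (coord e (x j)) with hlt | heq | hlt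
      · exact absurd (hinj h) (avg_lt e hlt).ne
      · obtain ⟨s, hs⟩ := hi
        obtain ⟨t, ht⟩ := hj
        rw [← hs, ← ht, coord_edgePt, coord_edgePt] at heq
        rw [hx (hs.symm.trans (heq ▸ ht))]
      · exact absurd (hinj h) (avg_lt e hlt).ne'
    · exact absurd ⟨_, h⟩ hj
    · exact absurd ⟨_, h.symm⟩ hi
    · rw [hx h]

theorem isClosed_range_edgePt : IsClosed (range ((star I).edgePt e)) := by
  have h : range ((star I).edgePt e) = (⋃ i ∈ {i : I | i ≠ e}, {p | coord i p ≠ 0})ᶜ := by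
    ext p
    simp only [mem_ofPred_eq, mem_compl_iff, mem_iUnion, not_exists, not_not]
    constructor
    · rintro ⟨t, rfl⟩ i hi
      exact coord_edgePt_of_ne e hi t
    · intro h
      by_cases hp : coord e p = 0
      · have hall : ∀ i, coord i p = 0 := fun i => by
          by_cases hi : i = e
          · rw [hi, hp]
          · exact h i hi
        rcases p with (_ | i) | ⟨i, t⟩
        · exact ⟨0, edgePt_zero _ _⟩
        · have := hall i
          simp [coord_vertex] at this
        · have := hall i
          rw [coord_cell, if_pos rfl] at this
          exact absurd this (toI_ne_zero t)
      · exact ⟨_, edgePt_coord e hp⟩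
  rw [h, isClosed_compl_iff]
  exact isOpen_biUnion fun i _ => isOpen_ne.preimage (coord i).continuous

theorem continuous_predCoord (j : ι) :
    Continuous fun x : Conf ι (star I).Space ∅ => predCoord e x.1 j := by
  classical
  have hc : ∀ i, Continuous fun x : Conf ι (star I).Space ∅ => coord e (x.1 i) := fun i =>
    (coord e).continuous.comp (Conf.continuous_eval i)
  refine Continuous.finset_sup_apply (fun i _ => ?_)
  have h : (fun x : Conf ι (star I).Space ∅ =>
      if coord e (x.1 i) < coord e (x.1 j) then coord e (x.1 i) else 0) =
      fun x => if coord e (x.1 j) ≤ coord e (x.1 i) then 0 else coord e (x.1 i) := by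
    funext x
    by_cases h : coord e (x.1 i) < coord e (x.1 j)
    · rw [if_pos h, if_neg h.not_ge]
    · rw [if_neg h, if_pos (not_lt.1 h)]
  by_cases hij : i = j
  · subst hij; simpa using continuous_const
  rw [h]
  refine Continuous.if_le continuous_const (hc i) (hc j) (hc i) fun x hx => ?_
  by_contra hne
  have hi : coord e (x.1 i) ≠ 0 := fun h => hne h.symm
  have hj : coord e (x.1 j) ≠ 0 := hx ▸ hi
  have : x.1 i = x.1 j := by rw [← edgePt_coord e hi, ← edgePt_coord e hj, hx]
  rcases x.2 i j this with h | h
  · exact hij h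
  · exact h

/-- Edge stabilization of ordered configurations in the star graph. -/
noncomputable def confStab : C(Conf ι (star I).Space ∅, Conf (Option ι) (star I).Space ∅) where
  toFun x := ⟨stabTuple e x.1, fun _ _ h => Or.inl (stabTuple_injective e
    (fun _ _ h' => (x.2 _ _ h').elim id False.elim) h)⟩
  continuous_toFun := by
    classical
    refine Conf.continuous_of_eval fun o => ?_
    have hc : ∀ i, Continuous fun x : Conf ι (star I).Space ∅ => coord e (x.1 i) := fun i =>
      (coord e).continuous.comp (Conf.continuous_eval i)
    rcases o with _ | j
    · exact ((star I).continuous_edgePt e).comp (continuous_avg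
        (Continuous.finset_sup_apply fun i _ => hc i) continuous_const)
    · change Continuous fun x : Conf ι (star I).Space ∅ =>
        if x.1 j ∈ range ((star I).edgePt e) then
          (star I).edgePt e (avg (predCoord e x.1 j) (coord e (x.1 j))) else x.1 j
      refine continuous_if (fun x hx => ?_) ?_ ?_
      · have hx1 : x.1 j ∈ range ((star I).edgePt e) :=
          ((isClosed_range_edgePt e).preimage (Conf.continuous_eval j)).frontier_subset hx
        have hx0 : coord e (x.1 j) = 0 := by
          by_contra h0
          refine hx.2 (mem_interior.2 ⟨{y | coord e (y.1 j) ≠ 0}, fun y hy => ?_,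
            isOpen_ne.preimage (hc j), h0⟩)
          exact ⟨_, edgePt_coord e hy⟩
        have hp : predCoord e x.1 j = 0 :=
          le_antisymm (hx0 ▸ predCoord_le e x.1 j) unitInterval.nonneg'
        obtain ⟨t, ht⟩ := hx1
        rw [← ht, coord_edgePt] at hx0
        rw [hp, ← ht, coord_edgePt, hx0]
        congr 1
        exact Subtype.ext (by simp [avg])
      · exact (((star I).continuous_edgePt e).comp
          (continuous_avg (continuous_predCoord e j) (hc j))).continuousOn
      · exact (Conf.continuous_eval j).continuousOn

theorem sup_perm (σ : Equiv.Perm ι) (f : ι → unitInterval) :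
    (Finset.univ.sup fun i => f (σ i)) = Finset.univ.sup f :=
  le_antisymm (Finset.sup_le fun i _ => Finset.le_sup (Finset.mem_univ (σ i)))
    (Finset.sup_le fun i _ => by
      simpa using Finset.le_sup (f := fun i => f (σ i)) (Finset.mem_univ (σ⁻¹ i)))

/-- The edge stabilization map `σ_e` from `B_k` to `B_{k+1}` of the star graph. -/
noncomputable def edgeStab (k : ℕ) : C(B k (star I).Space ∅, B (k + 1) (star I).Space ∅) :=
  (UConf.reindex (finSuccEquiv k)).comp
    { toFun := Quotient.lift (fun x => UConf.mk (confStab e x)) fun x y ⟨σ, h⟩ =>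
        UConf.mk_eq_mk.2 ⟨Equiv.optionCongr σ, by
          classical
          have hy : y.1 = fun i => x.1 (σ i) := funext h
          rintro (_ | j)
          · change stabTuple e y.1 none = stabTuple e x.1 none
            simp only [stabTuple, lastCoord, hy]
            rw [sup_perm σ fun i => coord e (x.1 i)]
          · change stabTuple e y.1 (some j) = stabTuple e x.1 (some (σ j))
            simp only [stabTuple, predCoord, hy]
            rw [sup_perm σ fun i => if coord e (x.1 i) < coord e (x.1 (σ j)) then
              coord e (x.1 i) else 0]⟩
      continuous_toFun :=
        Continuous.quotient_lift (UConf.continuous_mk.comp (confStab e).continuous) _ }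

end EdgeStabilization

section Loops

/-- The map from the circle determined by a loop. -/
noncomputable def circleMap {X : Type u} [TopologicalSpace X] {x : X} (p : Path x x) :
    C(UnitAddCircle, X) where
  toFun := AddCircle.liftIco 1 0 p.extend
  continuous_toFun := AddCircle.liftIco_continuous (by simp) p.continuous_extend.continuousOn

/-- The embedding of star graphs induced by an injection of index sets. -/
noncomputable def starInclusion {I : Type u} {J : Type v} (f : I → J) :
    C((star I).Space, (star J).Space) :=
  (star I).lift (fun i => .vertex (i.map f)) (fun i => (star J).edgeMap (f i))
    (fun _ => edgePt_zero _ _) (fun _ => edgePt_one _ _)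

theorem starInclusion_injective {I : Type u} {J : Type v} {f : I → J} (hf : Function.Injective f) :
    Function.Injective (starInclusion f) := by
  have hv : ∀ j, starInclusion f (.vertex j) = .vertex (j.map f) := fun _ => rfl
  have hc : ∀ i t, starInclusion f (.cell i t) = .cell (f i) t := fun i t => edgePt_toI _ _ _
  rintro (j | ⟨i, t⟩) (j' | ⟨i', t'⟩) h
  · rw [hv, hv] at h
    rw [Option.map_injective hf (Space.vertex_injective h)]
  · rw [hv, hc] at h; cases h
  · rw [hv, hc] at h; cases h
  · rw [hc, hc] at h
    obtain ⟨h1, h2⟩ := Space.cell_inj h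
    rw [hf h1, Subtype.ext h2]

/-- The `i`th leaf of the star graph with three edges. -/
def leaf (i : Fin 3) : (star (Fin 3)).Space := .vertex (some i)

/-- The linear path along the `i`th edge from the central vertex to the `i`th leaf. -/
noncomputable def ray (i : Fin 3) : Path (.vertex none : (star (Fin 3)).Space) (leaf i) where
  toFun := (star (Fin 3)).edgePt i
  continuous_toFun := (star (Fin 3)).continuous_edgePt i
  source' := edgePt_zero _ _
  target' := edgePt_one _ _

/-- The path from the `i`th to the `j`th leaf passing through the central vertex at time one half,
linear before and after. -/
noncomputable def legPath (i j : Fin 3) : Path (leaf i) (leaf j) := (ray i).symm.trans (ray j)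

theorem legPath_ne_leaf {i j k : Fin 3} (hi : k ≠ i) (hj : k ≠ j) (t : unitInterval) :
    leaf k ≠ legPath i j t := by
  have hr : ∀ i, k ≠ i → leaf k ∉ range (ray i) := by
    rintro i hi ⟨t, ht⟩
    refine (star (Fin 3)).edgePt_ne_vertex (x := some k) (e := i) (t := t) ?_ ?_ ht
    · intro _ h; cases h
    · intro _ h; exact hi (Option.some_injective _ h).symm
  intro h
  have hm : leaf k ∈ range (legPath i j) := ⟨t, h.symm⟩
  rw [legPath, Path.trans_range, Path.symm_range] at hm
  exact hm.elim (hr i hi) (hr j hj)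

/-- The ordered configuration of two distinct points. -/
noncomputable def pairConf {X : Type u} [TopologicalSpace X] {p q : X} (h : p ≠ q) : Conf (Fin 2) X ∅ :=
  ⟨![p, q], fun i j hij => by
    fin_cases i <;> fin_cases j <;> simp_all⟩

/-- The unordered configuration of two distinct leaves. -/
noncomputable def pair {i j : Fin 3} (h : i ≠ j) : B 2 (star (Fin 3)).Space ∅ :=
  UConf.mk (pairConf (p := leaf i) (q := leaf j) fun h' =>
    h (Option.some_injective _ (Space.vertex_injective h')))

theorem pair_comm {i j : Fin 3} (h : i ≠ j) : pair h = pair h.symm :=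
  UConf.mk_eq_mk.2 ⟨Equiv.swap 0 1, fun a => by fin_cases a <;> rfl⟩

/-- The path of configurations in which one particle rests at the `k`th leaf, while the other moves
from the `i`th to the `j`th leaf. -/
noncomputable def pairPath (k i j : Fin 3) (hi : k ≠ i) (hj : k ≠ j) :
    Path (pair hi) (pair hj) where
  toFun t := UConf.mk (pairConf (legPath_ne_leaf hi hj t))
  continuous_toFun := UConf.continuous_mk.comp <| Conf.continuous_of_eval fun a => by
    fin_cases a
    · exact continuous_const
    · exact (legPath i j).continuous
  source' := by
    congr 1
    exact Subtype.ext (by simp [pairConf])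
  target' := by
    congr 1
    exact Subtype.ext (by simp [pairConf])

/-- The loop `ε`, the threefold concatenation in which the particle at the second leaf moves to
the third, the one at the first leaf then moves to the second, and the one at the third leaf
then moves to the first. -/
noncomputable def epsilonPath :
    Path (pair (i := 0) (j := 1) (by decide)) (pair (i := 0) (j := 1) (by decide)) :=
  (pairPath 0 1 2 (by decide) (by decide)).trans
    (((pairPath 2 0 1 (by decide) (by decide)).cast (pair_comm _) rfl).trans
      ((pairPath 1 2 0 (by decide) (by decide)).cast (pair_comm _) (pair_comm _)))

/-- The map `ε` from the circle to `B_2` of the star graph with three edges. -/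
noncomputable def epsilon : C(UnitAddCircle, B 2 (star (Fin 3)).Space ∅) := circleMap epsilonPath

/-- The map on configuration spaces induced by the embedding of the star graph with three edges in
the star graph with `n` edges sending the `i`th edge to the `(i + a)`th. -/
noncomputable def iota (k a n : ℕ) (h : a + 3 ≤ n) :
    C(B k (star (Fin 3)).Space ∅, B k (star (Fin n)).Space ∅) :=
  UConf.map (starInclusion fun i : Fin 3 => (⟨i + a, by omega⟩ : Fin n))
    (NearMono.of_injective (starInclusion_injective fun i j h => by
      simpa [Fin.ext_iff] using h))

/-- The three types of essential vertices. -/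
inductive VertexType
  | high
  | separatingTrivalent
  | nonseparatingTrivalent

/-- The number `k(v)` of particles assigned to a vertex of the given type. -/
def VertexType.size : VertexType → ℕ
  | .high => 2
  | .separatingTrivalent => 3
  | .nonseparatingTrivalent => 2

/-- The map `φ_v^a` from the circle to the configuration space of the star graph with `n` edges,
for a vertex `v` of valence `n` and of type `c`. For trivalent vertices, `n = 3` and
`iota _ 0 n` is the identification of the star graphs on `3` and on `n` edges. -/
noncomputable def phi (a : Fin 2) (n : ℕ) (hn : 3 ≤ n) :
    (c : VertexType) → (c = .high → 4 ≤ n) → C(UnitAddCircle, B c.size (star (Fin n)).Space ∅)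
  | .high, h => (iota 2 a n (by have := h rfl; omega)).comp epsilon
  | .separatingTrivalent, _ =>
      (iota 3 0 n (by omega)).comp ((edgeStab (Fin.castLE (by decide) a : Fin 3) 2).comp epsilon)
  | .nonseparatingTrivalent, _ =>
      (iota 2 0 n (by omega)).comp
        (if a = 0 then epsilon else ContinuousMap.const _ (pair (i := 0) (j := 1) (by decide)))

end Loops

section Toric

variable {V : Type u} {E : Type v} (Γ : CellGraph V E)

open Classical in
/-- The type of an essential vertex. -/
noncomputable def vertexType (x : V) : VertexType :=
  if 4 ≤ Γ.valence x then .high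
  else if Γ.Separating x then .separatingTrivalent
  else .nonseparatingTrivalent

theorem four_le_valence {x : V} (h : Γ.vertexType x = .high) : 4 ≤ Γ.valence x := by
  unfold vertexType at h
  split_ifs at h with h1
  exact h1

/-- The total number `k(W)` of particles. -/
noncomputable def totalSize (W : Finset V) : ℕ := ∑ x : W, (Γ.vertexType x).size

/-- A bijection between the labels of the particles at the various vertices and the standard label
set; unordered configurations do not depend on its choice. -/
noncomputable def labelEquiv (W : Finset V) :
    Fin (Γ.totalSize W) ≃ Σ x : W, Fin (Γ.vertexType x).size :=
  (Fintype.equivFinOfCardEq (by simp [totalSize])).symm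

variable {Γ}

/-- The map from the product of the configuration spaces of the star graphs at the vertices of `W`
to the configuration space of `Γ`, induced by the embedding of the disjoint union of these star
graphs in `Γ`. -/
noncomputable def starUnion (hΓ : Γ.Subdivided) (W : Finset V) (hW : ∀ x ∈ W, Γ.Essential x)
    (o : ∀ x : W, Fin (Γ.valence x) ≃ Γ.Incident x.1) :
    C(∀ x : W, B (Γ.vertexType x).size (star (Fin (Γ.valence x))).Space ∅,
      B (Γ.totalSize W) Γ.Space ∅) :=
  (UConf.reindex (Γ.labelEquiv W)).comp
    (UConf.amalgamate (fun x : W => Fin (Γ.vertexType x).size) (fun x : W => Γ.starMap x.1 (o x))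
      fun x y p q h => by
        by_cases hxy : x = y
        · subst hxy
          rw [Γ.starMap_injective x.1 hΓ.loopless hΓ.simple (o x).injective h]
        · have hd := hΓ.disjoint_stars x.1 y.1 (hW _ x.2) (hW _ y.2) fun h' => hxy (Subtype.ext h')
          exact (disjoint_left.1 hd (Γ.starMap_mem_closedStar x.1 (o x) p)
            (h ▸ Γ.starMap_mem_closedStar y.1 (o y) q)).elim)

/-- The map `φ_W^a` from the torus to the configuration space of `Γ`. -/
noncomputable def torusMap (hΓ : Γ.Subdivided) (W : Finset V) (hW : ∀ x ∈ W, Γ.Essential x)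
    (o : ∀ x : W, Fin (Γ.valence x) ≃ Γ.Incident x.1) (a : Fin 2) :
    C(W → UnitAddCircle, B (Γ.totalSize W) Γ.Space ∅) :=
  (starUnion hΓ W hW o).comp
    (ContinuousMap.piMap fun x : W =>
      phi a (Γ.valence x) (hW _ x.2) (Γ.vertexType x) Γ.four_le_valence)

/-- The standard loop in the circle. -/
noncomputable def circleLoop : Path (0 : UnitAddCircle) 0 where
  toFun t := ((t : ℝ) : UnitAddCircle)
  continuous_toFun := (AddCircle.continuous_mk' 1).comp continuous_subtype_val
  source' := by simp
  target' := by simp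

/-- The identification of `ℤ ^ W` with the fundamental group of the torus: the `x`th coordinate
of the image of `n` is the `n x`th power of the class of the standard loop. -/
noncomputable def intPowToTorus (A : Type u) :
    Multiplicative (A → ℤ) →* FundamentalGroup (A → UnitAddCircle) 0 :=
  MonoidHom.mk'
    (fun n => FundamentalGroup.fromPath
      (Path.Homotopic.pi (as := fun _ : A => (0 : UnitAddCircle)) (bs := fun _ => 0) fun x =>
        FundamentalGroup.toPath
          ((FundamentalGroup.fromPath (.mk circleLoop) : FundamentalGroup UnitAddCircle 0) ^
            n.toAdd x)))
    (fun m n => by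
      refine Eq.trans ?_ (Path.Homotopic.comp_pi_eq_pi_comp _ _).symm
      exact congrArg Path.Homotopic.pi
        (funext fun x => zpow_add (G := FundamentalGroup UnitAddCircle 0) _ (m.toAdd x) (n.toAdd x)))

/-- The toric homomorphism `τ_W^a`, where `α` is a path from `φ_W^a(1)` to the basepoint. -/
noncomputable def toric (hΓ : Γ.Subdivided) (W : Finset V) (hW : ∀ x ∈ W, Γ.Essential x)
    (o : ∀ x : W, Fin (Γ.valence x) ≃ Γ.Incident x.1) (a : Fin 2)
    {x₀ : B (Γ.totalSize W) Γ.Space ∅} (α : Path (torusMap hΓ W hW o a 0) x₀) :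
    Multiplicative (W → ℤ) →* FundamentalGroup (B (Γ.totalSize W) Γ.Space ∅) x₀ :=
  (FundamentalGroup.fundamentalGroupMulEquivOfPath α).toMonoidHom.comp
    ((FundamentalGroup.map (torusMap hΓ W hW o a) 0).comp (intPowToTorus W))

/-- The detection homomorphism `δ`; the product is over all essential vertices. -/
noncomputable def detection [ConnectedSpace Γ.Space] (hl : ∀ e, Γ.src e ≠ Γ.tgt e) (k : ℕ)
    (x₀ : B k Γ.Space ∅) :
    FundamentalGroup (B k Γ.Space ∅) x₀ →*
      ∀ x : {x : V // Γ.Essential x},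
        FundamentalGroup (B k (Γ.localGraphAt x.1).Space (localSinks (Γ.edgeSetoid x.1)))
          (UConf.map (Γ.localQuotient hl x.1) (Γ.nearMono_localQuotient hl x.1) x₀) :=
  MonoidHom.pi fun x =>
    FundamentalGroup.map (UConf.map (Γ.localQuotient hl x.1) (Γ.nearMono_localQuotient hl x.1)) x₀

end Toric

end CellGraph

/-- The subgroup of `ℤ ^ A` of functions supported on `U`. -/
def supportedOn {A : Type u} (U : Set A) : Subgroup (Multiplicative (A → ℤ)) where
  carrier := {n | ∀ x, x ∉ U → n.toAdd x = 0}
  one_mem' := fun _ _ => rfl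
  mul_mem' := fun {m n} hm hn x hx => by simp [hm x hx, hn x hx]
  inv_mem' := fun {n} hn x hx => by simp [hn x hx]

/-- Two homomorphisms with a common target have disjoint conjugates if the only element of the
image of the first with a conjugate in the image of the second is the identity. -/
def DisjointConjugates {H₀ : Type u} {H₁ : Type v} {G : Type w} [Group H₀] [Group H₁] [Group G]
    (f₀ : H₀ →* G) (f₁ : H₁ →* G) : Prop :=
  ∀ h ∈ f₀.range, ∀ g : G, g * h * g⁻¹ ∈ f₁.range ↔ h = 1

end GraphBraid

/-! Nontriviality in `π₁` is detected by coverings: the monodromy of a covering is a homomorphism on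
the fundamental groupoid, so it can be evaluated leg by leg on the loops at hand, and a change of
basepoint only conjugates it. All coverings used here have fiber `ℤ × ℤ` and live over configuration
spaces of local graphs.

On such a space there are two open sets: no particle is at the central vertex, or some particle is
strictly closest to it and not at a sink. They cover because the central vertex is not a sink and so
holds at most one particle. On the overlap, the open edge carrying the closest particle and the
number of particles in a fixed branch are both locally constant, so any function `f` of these two
data is a cocycle and glues a covering. A particle leaving the center along edge `i`, with the
others far away, has monodromy `f` of `i` and of the branch count (`exists_localHolonomy`). Since
`ε` consists of six such half motions, its monodromy is an explicit word in values of `f`.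

If `f` depends on the edge only, with values `x, y, z` on the three edges, the word is `x z⁻¹ y x⁻¹
z y⁻¹`. It vanishes for `y = z`, and for `x = 1` it is a commutator. Taking a translation and a
shear for `y` and `z` gives a generator of the center of a Heisenberg group, of infinite order. At a
vertex of valence at least four, `f` can be trivial on the first edge, the translation on the second
and the shear on all others; it then sees `φ⁰`, which uses the first three edges, and kills `φ¹`,
which uses the next three. At a nonseparating trivalent vertex `φ¹` is constant. At a separating
trivalent vertex only three edges are available, so the count is used instead: the stabilizing
particle of `φ⁰` lies in the component of the first edge while that of `φ¹` does not, and a weight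
supported at one suitable count sees one loop and kills the other. This is `exists_holonomy_phi`.

Closed stars of distinct essential vertices are disjoint, so `q_v` collapses every star but that of
`v` into a sink. The image of the torus in `B_k(Λ(v))` therefore depends on the coordinate at `v`
only (`exists_local_factorization`), and the local monodromies read off the coordinates of `ℤ^W` one
at a time. Disjointness of conjugates follows because a single monodromy at each `v` detects the
coordinate of `τ⁰` and is trivial on all of the image of `τ¹`, a condition insensitive to
conjugation. -/

namespace GraphBraid

open Set Topology

universe u v w z

/-! ### Representations of the fundamental groupoid -/

section Holonomy

/-- A homomorphism from the fundamental groupoid of `X` to the group `G`. -/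
structure Holonomy (X : Type u) [TopologicalSpace X] (G : Type v) [Group G] where
  toFun : ∀ {x y : X}, Path.Homotopic.Quotient x y → G
  map_trans : ∀ {x y z : X} (p : Path.Homotopic.Quotient x y) (q : Path.Homotopic.Quotient y z),
    toFun (p.trans q) = toFun q * toFun p

namespace Holonomy

variable {X : Type u} [TopologicalSpace X] {Y : Type w} [TopologicalSpace Y] {G : Type v} [Group G]
  (H : Holonomy X G)

/-- The holonomy along a path. -/
def along {x y : X} (p : Path x y) : G := H.toFun (.mk p)

theorem along_trans {x y z : X} (p : Path x y) (q : Path y z) :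
    H.along (p.trans q) = H.along q * H.along p := H.map_trans (.mk p) (.mk q)

theorem toFun_refl (x : X) : H.toFun (.refl x) = 1 := by
  have h := H.along_trans (Path.refl x) (Path.refl x)
  rw [Path.refl_trans_refl] at h
  exact left_eq_mul.1 h

theorem along_refl (x : X) : H.along (Path.refl x) = 1 := H.toFun_refl x

theorem along_eq_of_homotopic {x y : X} {p q : Path x y} (h : p.Homotopic q) :
    H.along p = H.along q := congrArg H.toFun (Path.Homotopic.Quotient.eq.2 h)

theorem along_symm {x y : X} (p : Path x y) : H.along p.symm = (H.along p)⁻¹ := by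
  refine eq_inv_of_mul_eq_one_left ?_
  rw [← along_trans, ← H.along_refl x]
  exact H.along_eq_of_homotopic ⟨(Path.Homotopy.reflTransSymm p).symm⟩

theorem along_congr {x y x' y' : X} {p : Path x y} {q : Path x' y'} (h : ∀ t, p t = q t) :
    H.along p = H.along q := by
  obtain rfl : x = x' := by simpa using h 0
  obtain rfl : y = y' := by simpa using h 1
  rw [Path.ext (funext h)]

/-- This permits a path crossing from one chart of a covering to another to be evaluated one chart
at a time. -/
theorem along_subpath_mul {x y : X} (p : Path x y) (s : unitInterval) :
    H.along p = H.along (p.subpath s 1) * H.along (p.subpath 0 s) := by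
  rw [← along_trans, H.along_eq_of_homotopic ⟨Path.Homotopy.subpathTransSubpath p 0 s 1⟩]
  exact H.along_congr fun t => by simp

/-- The holonomy pulled back along a continuous map. -/
def pullback (f : C(Y, X)) : Holonomy Y G where
  toFun p := H.toFun (p.map f)
  map_trans := Path.Homotopic.Quotient.ind₂ fun _ _ => by
    rw [← H.map_trans]
    exact congrArg (fun r => H.toFun (Path.Homotopic.Quotient.mk r))
      (Path.map_trans _ _ f.continuous)

theorem pullback_along (f : C(Y, X)) {x y : Y} (p : Path x y) :
    (H.pullback f).along p = H.along (p.map f.continuous) := rfl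

/-- The homomorphism from the fundamental group determined by a holonomy. -/
def hom (x : X) : FundamentalGroup X x →* G where
  toFun p := H.toFun (FundamentalGroup.toPath p)
  map_one' := H.toFun_refl x
  map_mul' _ _ := H.map_trans _ _

/-- The paths `α` to the basepoint are arbitrary; since they enter only through a conjugation, they
cannot affect whether a value is trivial. -/
theorem hom_changeBase {x y : X} (p : Path x y) (q : FundamentalGroup X x) :
    H.hom y (FundamentalGroup.fundamentalGroupMulEquivOfPath p q) =
      H.along p * H.hom x q * (H.along p)⁻¹ := by
  rw [← along_symm]
  change H.toFun ((Path.Homotopic.Quotient.mk p.symm).trans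
    (Path.Homotopic.Quotient.trans (FundamentalGroup.toPath q) (.mk p))) = _
  rw [H.map_trans, H.map_trans]
  rfl

end Holonomy

end Holonomy

/-! ### Monodromy of coverings glued from two trivial ones -/

section Cocycle

variable {X : Type u} [TopologicalSpace X] {F : Type v} [TopologicalSpace F] [DiscreteTopology F]

/-- The transition functions of the covering glued from trivial ones along a cocycle. -/
def transition (c : X → Equiv.Perm F) (i : Bool) (x : X) : Equiv.Perm F := bif i then c x else 1

open Classical in
/-- The bundle core of the covering with fiber `F` glued from trivial coverings of two open sets
along a locally constant function on their intersection. -/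
noncomputable def cocycleCore (U : Bool → Set X) (hU : ∀ i, IsOpen (U i))
    (hcover : ∀ x, x ∉ U false → x ∈ U true) (c : X → Equiv.Perm F)
    (hc : ∀ x ∈ U false ∩ U true, ∀ᶠ y in 𝓝 x, c y = c x) : FiberBundleCore Bool X F where
  baseSet := U
  isOpen_baseSet := hU
  indexAt x := decide (x ∉ U false)
  mem_baseSet_at x := by
    by_cases h : x ∈ U false
    · simp [h]
    · simpa [h] using hcover x h
  coordChange i j x a := (transition c j x)⁻¹ (transition c i x a)
  coordChange_self i x _ a := by simp
  continuousOn_coordChange i j := by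
    rintro ⟨x, a⟩ ⟨hx, -⟩
    refine ContinuousAt.continuousWithinAt ?_
    -- With equal indices the transition is the identity; with distinct indices the point lies in
    -- both sets, where `c` is locally constant.
    have key : ∀ᶠ y in 𝓝 x, (transition c j y)⁻¹ * transition c i y =
        (transition c j x)⁻¹ * transition c i x := by
      cases i <;> cases j
      · exact Filter.Eventually.of_forall fun y => by simp
      · filter_upwards [hc x hx] with y hy
        simp [transition, hy]
      · filter_upwards [hc x hx.symm] with y hy
        simp [transition, hy]
      · exact Filter.Eventually.of_forall fun y => by simp
    have hc' : ContinuousAt (fun p : X × F => ((transition c j x)⁻¹ * transition c i x) p.2)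
      (x, a) := (continuous_of_discreteTopology.comp continuous_snd).continuousAt
    refine hc'.congr ?_
    rw [nhds_prod_eq]
    filter_upwards [key.prod_inl _] with p hp
    rw [← hp]
    rfl
  coordChange_comp i j k x _ a := by simp

variable {ι : Type w} {Z : FiberBundleCore ι X F}

/-- The fiber of the total space of a bundle core. -/
def coreFiberEquiv (Z : FiberBundleCore ι X F) (x : X) : F ≃ Z.proj ⁻¹' {x} where
  toFun a := ⟨⟨x, a⟩, rfl⟩
  invFun p := p.1.2
  left_inv _ := rfl
  right_inv := by
    rintro ⟨⟨y, a⟩, rfl⟩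
    rfl

theorem isCoveringMap_core (Z : FiberBundleCore ι X F) : IsCoveringMap Z.proj :=
  FiberBundle.isCoveringMap (F := F) (E := Z.Fiber)

/-- The monodromy of a bundle core with discrete fibers. -/
noncomputable def coreHolonomy (Z : FiberBundleCore ι X F) : Holonomy X (Equiv.Perm F) where
  toFun {x y} p := ((coreFiberEquiv Z x).trans (Equiv.ofBijective _
    ((isCoveringMap_core Z).monodromy_bijective p))).trans (coreFiberEquiv Z y).symm
  map_trans p q := by
    ext a
    simp [(isCoveringMap_core Z).monodromy_trans_apply]

/-- Over a single chart the lift of a path is a constant section, so the monodromy only records the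
passage between chart `i` and the preferred charts at the two endpoints. -/
theorem coreHolonomy_apply (Z : FiberBundleCore ι X F) {x y : X} (p : Path x y) (i : ι)
    (h : ∀ t, p t ∈ Z.baseSet i) (a : F) :
    (coreHolonomy Z).along p (Z.coordChange i (Z.indexAt x) x a) =
      Z.coordChange i (Z.indexAt y) y a := by
  let P : Path (⟨x, Z.coordChange i (Z.indexAt x) x a⟩ : Z.TotalSpace)
      ⟨y, Z.coordChange i (Z.indexAt y) y a⟩ :=
    { toFun := fun t => ⟨p t, Z.coordChange i (Z.indexAt (p t)) (p t) a⟩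
      continuous_toFun := by
        have h1 := (Z.localTriv i).toOpenPartialHomeomorph.symm.continuousOn
        refine h1.comp_continuous (f := fun t => (p t, a))
          (p.continuous.prodMk continuous_const) fun t => ?_
        exact (Z.mem_localTriv_target i (p t, a)).2 (h t)
      source' := by rw [p.source]
      target' := by rw [p.target] }
  have h1 := (isCoveringMap_core Z).monodromy_map (.mk P)
  have h2 : (coreHolonomy Z).along p (Z.coordChange i (Z.indexAt x) x a) =
    (coreFiberEquiv Z y).symm ((isCoveringMap_core Z).monodromy (.mk p)
      ⟨⟨x, Z.coordChange i (Z.indexAt x) x a⟩, rfl⟩) := rfl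
  rw [h2, Equiv.symm_apply_eq]
  exact h1

/-- The holonomy of the covering glued from trivial coverings of two open sets along a locally
constant function on their intersection. -/
theorem exists_holonomy (U₀ U₁ : Set X) (h₀ : IsOpen U₀) (h₁ : IsOpen U₁)
    (hcover : ∀ x, x ∉ U₀ → x ∈ U₁) (c : X → Equiv.Perm F)
    (hc : ∀ x ∈ U₀ ∩ U₁, ∀ᶠ y in 𝓝 x, c y = c x) :
    ∃ H : Holonomy X (Equiv.Perm F), ∀ {x y : X} (p : Path x y) (s : unitInterval), x ∉ U₀ →
      (∀ t ≤ s, p t ∈ U₁) → (∀ t ≥ s, p t ∈ U₀) → H.along p = c (p s) := by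
  classical
  let Z := cocycleCore (fun i => bif i then U₁ else U₀) (by rintro (_ | _) <;> assumption)
    hcover c hc
  refine ⟨coreHolonomy Z, fun {x y} p s hx hs hs' => ?_⟩
  have hZ : ∀ i j x a, Z.coordChange i j x a = (transition c j x)⁻¹ (transition c i x a) :=
    fun _ _ _ _ => rfl
  have hf : ∀ x, transition c false x = 1 := fun _ => rfl
  have ht : ∀ x, transition c true x = c x := fun _ => rfl
  have hin : ∀ x, x ∈ U₀ → Z.indexAt x = false := fun x hx => by simpa [Z, cocycleCore] using hx
  have hout : ∀ x, x ∉ U₀ → Z.indexAt x = true := fun x hx => by simpa [Z, cocycleCore] using hx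
  -- After time `s` the path stays in `U₀`, whose chart is the preferred one wherever it is defined,
  -- so nothing is picked up.
  have e1 : (coreHolonomy Z).along (p.subpath s 1) = 1 := by
    ext1 a
    have := coreHolonomy_apply Z (p.subpath s 1) false (fun t => by
      have : p.subpath s 1 t ∈ range (p.subpath s 1) := ⟨t, rfl⟩
      rw [Path.range_subpath_of_le _ _ _ unitInterval.le_one'] at this
      obtain ⟨r, hr, h⟩ := this
      rw [← h]
      exact hs' r hr.1) a
    rw [hin _ (hs' _ le_rfl), hin _ (hs' 1 unitInterval.le_one')] at this
    simpa only [hZ, hf, ht, inv_one, Equiv.Perm.one_apply, Equiv.Perm.inv_def,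
      Equiv.symm_apply_apply] using this
  -- Up to time `s` the lift is constant in the chart of `U₁`. This chart is preferred at the start,
  -- which is outside `U₀`, but not at time `s`, and the discrepancy there is `c`.
  have e2 : (coreHolonomy Z).along (p.subpath 0 s) = c (p s) := by
    ext1 a
    have := coreHolonomy_apply Z (p.subpath 0 s) true (fun t => by
      have : p.subpath 0 s t ∈ range (p.subpath 0 s) := ⟨t, rfl⟩
      rw [Path.range_subpath_of_le _ _ _ unitInterval.nonneg'] at this
      obtain ⟨r, hr, h⟩ := this
      rw [← h]
      exact hs r hr.2) a
    rw [hin _ (hs' _ le_rfl), hout _ (by simpa using hx)] at this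
    simpa only [hZ, hf, ht, inv_one, Equiv.Perm.one_apply, Equiv.Perm.inv_def,
      Equiv.symm_apply_apply] using this
  rw [(coreHolonomy Z).along_subpath_mul p s, e1, e2, one_mul]

end Cocycle

/-! ### Unordered configurations as multisets -/

section Multisets

set_option linter.unusedSectionVars false

variable {ι : Type u} {X : Type v} [TopologicalSpace X] {S : Set X}

/-- The multiset of points of an unordered configuration. -/
def UConf.points [Fintype ι] : UConf ι X S → Multiset X :=
  Quotient.lift (fun x => Finset.univ.val.map x.1) fun x y ⟨σ, h⟩ => by
    have : y.1 = x.1 ∘ σ := funext h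
    simp only [this, ← Multiset.map_map]
    congr 1
    exact (congrArg Finset.val (Finset.map_univ_equiv σ)).symm

variable [Fintype ι]

theorem UConf.points_mk (x : Conf ι X S) : (UConf.mk x).points = Finset.univ.val.map x.1 := rfl

theorem UConf.points_reindex {κ : Type w} [Fintype κ] (e : κ ≃ ι) (x : UConf ι X S) :
    (UConf.reindex e x).points = x.points := by
  induction x using Quotient.inductionOn with | _ x => ?_
  change Finset.univ.val.map (x.1 ∘ e) = Finset.univ.val.map x.1
  rw [← Multiset.map_map]
  exact congrArg _ (congrArg Finset.val (Finset.map_univ_equiv e))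

theorem UConf.points_map {Y : Type w} [TopologicalSpace Y] {T : Set Y} (f : C(X, Y))
    (hf : NearMono f S T) (x : UConf ι X S) : (UConf.map f hf x).points = x.points.map f := by
  induction x using Quotient.inductionOn with | _ x => ?_
  exact (Multiset.map_map f x.1 Finset.univ.val).symm

/-- Singling out a point of the multiset amounts to choosing a label. This translates conditions on
unordered configurations into ones on labelled coordinates, where continuity is available. -/
theorem points_mk_eq_cons [DecidableEq ι] {x : Conf ι X S} {p : X} {m : Multiset X} :
    (UConf.mk x).points = p ::ₘ m ↔ ∃ j, x.1 j = p ∧ (Finset.univ.val.erase j).map x.1 = m := by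
  rw [UConf.points_mk]
  constructor
  · intro h
    obtain ⟨j, -, hj⟩ := Multiset.mem_map.1 (h ▸ Multiset.mem_cons_self p m)
    refine ⟨j, hj, ?_⟩
    rw [← Multiset.cons_inj_right p, ← h, ← hj, ← Multiset.map_cons, Multiset.cons_erase]
    exact Finset.mem_univ j
  · rintro ⟨j, rfl, rfl⟩
    rw [← Multiset.map_cons, Multiset.cons_erase]
    exact Finset.mem_univ j

end Multisets

/-! ### Coverings of configuration spaces of local graphs -/

namespace CellGraph

section LocalHolonomy

variable {I : Type u} (r : Setoid I)

/-- The distance from the central vertex in a local graph. -/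
noncomputable def radius : C((localGraph r).Space, unitInterval) :=
  (localGraph r).lift (fun j => j.elim 0 fun _ => 1) (fun _ => ContinuousMap.id _)
    (fun _ => rfl) (fun _ => rfl)

/-- The open edge `i` of a local graph. -/
def openEdge (i : I) : Set (localGraph r).Space := {p | ∃ t, p = .cell i t}

variable {r} in
/-- The component of the sink `s` in the complement of the central vertex of a local graph. -/
def branch (s : Quotient r) : Set (localGraph r).Space :=
  {p | p = .vertex (some s) ∨ ∃ i t, Quotient.mk r i = s ∧ p = .cell i t}

theorem radius_vertex_none : radius r (.vertex none) = 0 := rfl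

theorem radius_edgePt (i : I) (t : unitInterval) : radius r ((localGraph r).edgePt i t) = t := by
  by_cases h0 : t = 0
  · subst h0; rw [edgePt_zero]; rfl
  by_cases h1 : t = 1
  · subst h1; rw [edgePt_one]; rfl
  obtain ⟨s, rfl⟩ := exists_toI h0 h1
  rw [edgePt_toI]; rfl

theorem radius_eq_zero {p : (localGraph r).Space} : radius r p = 0 ↔ p = .vertex none := by
  constructor
  · intro h
    rcases p with (_ | s) | ⟨i, t⟩
    · rfl
    · exact absurd h one_ne_zero
    · exact absurd h (toI_ne_zero t)
  · rintro rfl; rfl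

theorem edgePt_mem_openEdge {i : I} {t : unitInterval} (h0 : t ≠ 0) (h1 : t ≠ 1) :
    (localGraph r).edgePt i t ∈ openEdge r i := by
  obtain ⟨s, rfl⟩ := exists_toI h0 h1
  exact ⟨s, edgePt_toI _ _ _⟩

variable {r} in
theorem edgePt_mem_branch {i : I} {t : unitInterval} (h0 : t ≠ 0) {s : Quotient r} :
    (localGraph r).edgePt i t ∈ branch s ↔ Quotient.mk r i = s := by
  by_cases h1 : t = 1
  · subst h1
    rw [edgePt_one]
    constructor
    · rintro (h | ⟨_, _, _, h⟩)
      · exact Option.some_injective _ (Space.vertex_injective h)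
      · cases h
    · intro h; exact Or.inl (congrArg (fun c => Space.vertex (some c)) h)
  obtain ⟨t, rfl⟩ := exists_toI h0 h1
  rw [edgePt_toI]
  constructor
  · rintro (h | ⟨j, t', h, h'⟩)
    · cases h
    · rw [(Space.cell_inj h').1, h]
  · intro h; exact Or.inr ⟨i, t, h, rfl⟩

theorem isOpen_openEdge (i : I) : IsOpen (openEdge r i) := by
  classical
  rw [isOpen_iff]
  intro j
  by_cases hij : j = i
  · subst hij
    have : (localGraph r).edgePt j ⁻¹' openEdge r j = {0}ᶜ ∩ {1}ᶜ := by
      ext t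
      refine ⟨?_, fun h => edgePt_mem_openEdge r h.1 h.2⟩
      rintro ⟨s, hs⟩
      constructor
      · rintro rfl; rw [edgePt_zero] at hs; cases hs
      · rintro rfl; rw [edgePt_one] at hs; cases hs
    rw [this]
    exact isOpen_compl_singleton.inter isOpen_compl_singleton
  · have : (localGraph r).edgePt j ⁻¹' openEdge r i = ∅ := by
      refine eq_empty_iff_forall_notMem.2 fun t ⟨s, hs⟩ => ?_
      by_cases h0 : t = 0
      · subst h0; rw [edgePt_zero] at hs; cases hs
      by_cases h1 : t = 1
      · subst h1; rw [edgePt_one] at hs; cases hs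
      obtain ⟨t, rfl⟩ := exists_toI h0 h1
      rw [edgePt_toI] at hs
      exact hij (Space.cell_inj hs).1
    rw [this]
    exact isOpen_empty

theorem isOpen_branch (s : Quotient r) : IsOpen (branch s) := by
  rw [isOpen_iff]
  intro i
  have key : ∀ t, t ≠ 0 → (t ∈ (localGraph r).edgePt i ⁻¹' branch s ↔ Quotient.mk r i = s) :=
    fun t ht => edgePt_mem_branch ht
  have h0 : (0 : unitInterval) ∉ (localGraph r).edgePt i ⁻¹' branch s := by
    rw [mem_preimage, edgePt_zero]
    rintro (h | ⟨_, _, _, h⟩) <;> cases h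
  by_cases h : Quotient.mk r i = s
  · have : (localGraph r).edgePt i ⁻¹' branch s = {0}ᶜ := by
      ext t
      by_cases ht : t = 0
      · subst ht; simpa using h0
      · simpa [h, ht] using key t ht
    rw [this]
    exact isOpen_compl_singleton
  · have : (localGraph r).edgePt i ⁻¹' branch s = ∅ := by
      refine eq_empty_iff_forall_notMem.2 fun t ht => ?_
      by_cases ht0 : t = 0
      · subst ht0; exact h0 ht
      · exact h ((key t ht0).1 ht)
    rw [this]
    exact isOpen_empty

theorem exists_mem_branch {p : (localGraph r).Space} (hp : p ≠ .vertex none) :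
    ∃ s, p ∈ branch s := by
  rcases p with (_ | s) | ⟨i, t⟩
  · exact absurd rfl hp
  · exact ⟨s, Or.inl rfl⟩
  · exact ⟨_, Or.inr ⟨i, t, rfl, rfl⟩⟩

variable {r} in
theorem branch_unique {p : (localGraph r).Space} {s s' : Quotient r} (h : p ∈ branch s)
    (h' : p ∈ branch s') : s = s' := by
  rcases h with rfl | ⟨i, t, rfl, rfl⟩ <;> rcases h' with h' | ⟨i', t', rfl, h'⟩
  · exact Option.some_injective _ (Space.vertex_injective h')
  · cases h'
  · cases h'
  · rw [(Space.cell_inj h').1]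

/-- Membership in a branch is locally constant away from the central vertex. -/
theorem eventually_mem_branch {p : (localGraph r).Space} (hp : p ≠ .vertex none) (s : Quotient r) :
    ∀ᶠ q in 𝓝 p, (q ∈ branch s ↔ p ∈ branch s) := by
  obtain ⟨s', hs'⟩ := exists_mem_branch r hp
  filter_upwards [(isOpen_branch r s').mem_nhds hs'] with q hq
  constructor
  · intro h; rwa [branch_unique h hq]
  · intro h; rwa [branch_unique h hs']

variable {k : ℕ}

/-- The configurations in a local graph having a particle closer to the central vertex than all
others and not at a sink. -/
def leadSet (k : ℕ) : Set (B k (localGraph r).Space (localSinks r)) :=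
  {x | ∃ p m, x.points = p ::ₘ m ∧ radius r p < 1 ∧ ∀ q ∈ m, radius r p < radius r q}

/-- The configurations in a local graph with no particle at the central vertex. -/
def vacantSet (k : ℕ) : Set (B k (localGraph r).Space (localSinks r)) :=
  {x | .vertex none ∉ x.points}

/-- The particle closest to the central vertex is unique and lies on the open edge `i`. -/
def Leads (i : I) (x : B k (localGraph r).Space (localSinks r)) : Prop :=
  ∃ p m, x.points = p ::ₘ m ∧ p ∈ openEdge r i ∧ ∀ q ∈ m, radius r p < radius r q

open Classical in
/-- The number of particles in a branch of a local graph. -/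
noncomputable def branchCount (s : Quotient r) (m : Multiset (localGraph r).Space) : ℕ :=
  m.countP (· ∈ branch s)

/-- Two different closest particles would each be strictly closer to the center than the other. -/
theorem leads_unique {x : B k (localGraph r).Space (localSinks r)} {i j : I} (hi : Leads r i x)
    (hj : Leads r j x) : i = j := by
  obtain ⟨p, m, h, ⟨t, rfl⟩, hm⟩ := hi
  obtain ⟨p', m', h', ⟨t', rfl⟩, hm'⟩ := hj
  rw [h] at h'
  rcases Multiset.cons_eq_cons.1 h' with ⟨h1, _⟩ | ⟨_, n, rfl, rfl⟩
  · exact (Space.cell_inj h1).1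
  · exact absurd (hm _ (Multiset.mem_cons_self _ _)) (hm' _ (Multiset.mem_cons_self _ _)).not_gt

theorem mem_leadSet_mk {x : Conf (Fin k) (localGraph r).Space (localSinks r)} :
    UConf.mk x ∈ leadSet r k ↔
      ∃ j, radius r (x.1 j) < 1 ∧ ∀ j', j' ≠ j → radius r (x.1 j) < radius r (x.1 j') := by
  constructor
  · rintro ⟨p, m, h, h1, hm⟩
    obtain ⟨j, rfl, rfl⟩ := points_mk_eq_cons.1 h
    refine ⟨j, h1, fun j' hj' => hm _ (Multiset.mem_map_of_mem _ ?_)⟩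
    exact (Multiset.mem_erase_of_ne hj').2 (Finset.mem_univ j')
  · rintro ⟨j, h1, hj⟩
    refine ⟨x.1 j, _, points_mk_eq_cons.2 ⟨j, rfl, rfl⟩, h1, fun q hq => ?_⟩
    obtain ⟨j', hj', rfl⟩ := Multiset.mem_map.1 hq
    exact hj j' ((Multiset.Nodup.mem_erase_iff Finset.univ.nodup).1 hj').1

theorem leads_mk {x : Conf (Fin k) (localGraph r).Space (localSinks r)} {i : I} :
    Leads r i (UConf.mk x) ↔
      ∃ j, x.1 j ∈ openEdge r i ∧ ∀ j', j' ≠ j → radius r (x.1 j) < radius r (x.1 j') := by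
  constructor
  · rintro ⟨p, m, h, h1, hm⟩
    obtain ⟨j, rfl, rfl⟩ := points_mk_eq_cons.1 h
    refine ⟨j, h1, fun j' hj' => hm _ (Multiset.mem_map_of_mem _ ?_)⟩
    exact (Multiset.mem_erase_of_ne hj').2 (Finset.mem_univ j')
  · rintro ⟨j, h1, hj⟩
    refine ⟨x.1 j, _, points_mk_eq_cons.2 ⟨j, rfl, rfl⟩, h1, fun q hq => ?_⟩
    obtain ⟨j', hj', rfl⟩ := Multiset.mem_map.1 hq
    exact hj j' ((Multiset.Nodup.mem_erase_iff Finset.univ.nodup).1 hj').1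

theorem mem_vacantSet_mk {x : Conf (Fin k) (localGraph r).Space (localSinks r)} :
    UConf.mk x ∈ vacantSet r k ↔ ∀ j, x.1 j ≠ .vertex none := by
  simp [vacantSet, UConf.points_mk]

theorem isOpen_preimage_mk {ι : Type w} {X : Type v} [TopologicalSpace X] {S : Set X}
    {U : Set (UConf ι X S)} : IsOpen ((UConf.mk : Conf ι X S → UConf ι X S) ⁻¹' U) ↔ IsOpen U :=
  UConf.isOpenQuotientMap_mk.isQuotientMap.isOpen_preimage

theorem continuous_radius_eval (j : Fin k) : Continuous
    fun x : Conf (Fin k) (localGraph r).Space (localSinks r) => radius r (x.1 j) :=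
  (radius r).continuous.comp (Conf.continuous_eval j)

theorem isOpen_leadSet : IsOpen (leadSet r k) := by
  rw [← isOpen_preimage_mk]
  have : (UConf.mk : _ → B k (localGraph r).Space (localSinks r)) ⁻¹' leadSet r k =
      ⋃ j, {x | radius r (x.1 j) < 1} ∩
        ⋂ j', {x | j' ≠ j → radius r (x.1 j) < radius r (x.1 j')} := by
    ext x
    simp only [mem_preimage, mem_leadSet_mk, mem_iUnion, mem_inter_iff, mem_iInter, mem_ofPred_eq]
  rw [this]
  refine isOpen_iUnion fun j => ((isOpen_lt (continuous_radius_eval r j)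
    continuous_const)).inter (isOpen_iInter_of_finite fun j' => ?_)
  by_cases h : j' = j
  · simp [h]
  · simpa [h] using isOpen_lt (continuous_radius_eval r j) (continuous_radius_eval r j')

theorem isOpen_vacantSet : IsOpen (vacantSet r k) := by
  rw [← isOpen_preimage_mk]
  have : (UConf.mk : _ → B k (localGraph r).Space (localSinks r)) ⁻¹' vacantSet r k =
      ⋂ j, {x | radius r (x.1 j) ≠ 0} := by
    ext x
    simp only [mem_preimage, mem_vacantSet_mk, mem_iInter, mem_ofPred_eq, ne_eq, radius_eq_zero]
  rw [this]
  exact isOpen_iInter_of_finite fun j => isOpen_ne.preimage (continuous_radius_eval r j)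

/-- The central vertex is not a sink, so a particle there is alone and every other one has positive
radius. -/
theorem mem_leadSet_of_notMem_vacantSet (x : B k (localGraph r).Space (localSinks r))
    (hx : x ∉ vacantSet r k) : x ∈ leadSet r k := by
  induction x using Quotient.inductionOn with | _ x => ?_
  change UConf.mk x ∉ _ at hx
  change UConf.mk x ∈ _
  rw [mem_vacantSet_mk] at hx
  push Not at hx
  obtain ⟨j, hj⟩ := hx
  refine (mem_leadSet_mk r).2 ⟨j, ?_, fun j' hj' => ?_⟩
  · rw [hj]; exact zero_lt_one
  · rw [hj, radius_vertex_none, unitInterval.pos_iff_ne_zero, Ne, radius_eq_zero]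
    intro h
    rcases x.2 j j' (hj.trans h.symm) with h' | ⟨c, h'⟩
    · exact hj' h'.symm
    · rw [hj] at h'; cases h'

/-- The closest particle is neither at the center nor at a sink, which leaves only the open edges.
-/
theorem exists_leads {x : B k (localGraph r).Space (localSinks r)}
    (hx : x ∈ vacantSet r k ∩ leadSet r k) : ∃ i, Leads r i x := by
  obtain ⟨h0, p, m, h, h1, hm⟩ := hx
  rcases p with (_ | s) | ⟨i, t⟩
  · exact absurd (h ▸ Multiset.mem_cons_self _ _) h0
  · exact absurd h1 (lt_irrefl _)
  · exact ⟨i, _, m, h, ⟨t, rfl⟩, hm⟩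

open Classical in
/-- The transition function given by the edge of the particle closest to the central vertex, and
by the number of particles in a branch. -/
noncomputable def leadCocycle {G : Type w} [Group G] (s : Quotient r) (f : I → ℕ → G)
    (x : B k (localGraph r).Space (localSinks r)) : G :=
  if h : ∃ i, Leads r i x then f h.choose (branchCount r s x.points) else 1

theorem leadCocycle_eq {G : Type w} [Group G] (s : Quotient r) (f : I → ℕ → G)
    {x : B k (localGraph r).Space (localSinks r)} {i : I} (h : Leads r i x) :
    leadCocycle r s f x = f i (branchCount r s x.points) := by
  have h' : ∃ i, Leads r i x := ⟨i, h⟩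
  rw [leadCocycle, dif_pos h', leads_unique r h'.choose_spec h]

/-- Being closest is a finite set of strict inequalities, and open edges and branches are open.
Without a particle at the center, no particle can change branch under a small motion, so the count
is stable as well. -/
theorem eventually_leadCocycle_eq {G : Type w} [Group G] (s : Quotient r) (f : I → ℕ → G)
    (x : B k (localGraph r).Space (localSinks r)) (hx : x ∈ vacantSet r k ∩ leadSet r k) :
    ∀ᶠ y in 𝓝 x, leadCocycle r s f y = leadCocycle r s f x := by
  classical
  obtain ⟨i, hi⟩ := exists_leads r hx
  rw [leadCocycle_eq r s f hi]
  obtain ⟨hx, -⟩ := hx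
  induction x using Quotient.inductionOn with | _ x => ?_
  change Leads r i (UConf.mk x) at hi
  change UConf.mk x ∈ _ at hx
  change ∀ᶠ y in 𝓝 (UConf.mk x), leadCocycle r s f y =
    f i (branchCount r s (UConf.mk x).points)
  rw [mem_vacantSet_mk] at hx
  obtain ⟨j, hj, hjj⟩ := (leads_mk r).1 hi
  -- The quotient by the symmetric group is open, so neighborhoods may be tested on labelled
  -- configurations.
  rw [← UConf.isOpenQuotientMap_mk.map_nhds_eq, Filter.eventually_map]
  have e1 : ∀ᶠ y : Conf (Fin k) (localGraph r).Space (localSinks r) in 𝓝 x,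
      y.1 j ∈ openEdge r i :=
    (Conf.continuous_eval j).continuousAt ((isOpen_openEdge r i).mem_nhds hj)
  have e2 : ∀ᶠ y : Conf (Fin k) (localGraph r).Space (localSinks r) in 𝓝 x,
      ∀ j', j' ≠ j → radius r (y.1 j) < radius r (y.1 j') := by
    rw [Filter.eventually_all]
    intro j'
    by_cases h : j' = j
    · exact Filter.Eventually.of_forall fun y h' => absurd h h'
    · filter_upwards [(isOpen_lt (continuous_radius_eval r j)
        (continuous_radius_eval r j')).mem_nhds (hjj j' h)] with y hy _ using hy
  have e3 : ∀ᶠ y : Conf (Fin k) (localGraph r).Space (localSinks r) in 𝓝 x,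
      ∀ j', (y.1 j' ∈ branch s ↔ x.1 j' ∈ branch s) := by
    rw [Filter.eventually_all]
    intro j'
    exact (Conf.continuous_eval j').continuousAt.eventually (eventually_mem_branch r (hx j') s)
  filter_upwards [e1, e2, e3] with y h1 h2 h3
  rw [leadCocycle_eq r s f ((leads_mk r).2 ⟨j, h1, h2⟩)]
  congr 1
  simp only [branchCount, UConf.points_mk, Multiset.countP_map, h3]

/-- The holonomy in the configuration space of a local graph which counts crossings of the central
vertex, weighted by the edge along which it is approached and by the number of particles in a
branch. -/
theorem exists_localHolonomy {F : Type w} [TopologicalSpace F] [DiscreteTopology F]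
    (s : Quotient r) (f : I → ℕ → Equiv.Perm F) (k : ℕ) :
    ∃ H : Holonomy (B k (localGraph r).Space (localSinks r)) (Equiv.Perm F),
      ∀ {x y : B k (localGraph r).Space (localSinks r)} (p : Path x y) (i : I) (N : ℕ),
        (∀ t : unitInterval, ∃ (ρ : unitInterval) (m : Multiset (localGraph r).Space),
          (t : ℝ) / 2 ≤ ρ ∧ ρ ≤ t ∧ (p t).points = (localGraph r).edgePt i ρ ::ₘ m ∧
          (∀ q ∈ m, (1 / 2 : ℝ) ≤ radius r q) ∧ branchCount r s m = N) →
        H.along p = f i (N + branchCount r s {(localGraph r).edgePt i 1}) := by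
  classical
  obtain ⟨H, hH⟩ := exists_holonomy (vacantSet r k) (leadSet r k) (isOpen_vacantSet r)
    (isOpen_leadSet r) (mem_leadSet_of_notMem_vacantSet r) (leadCocycle r s f)
    (eventually_leadCocycle_eq r s f)
  refine ⟨H, fun {x y} p i N hp => ?_⟩
  -- At times up to `1/4` the moving particle has radius at most `1/4`, less than the `1/2` of the
  -- others, so it leads; from then on its radius is at least `1/8`, so the center is vacant. The
  -- cocycle is read off at the switch.
  let t₀ : unitInterval := ⟨1 / 4, by norm_num, by norm_num⟩
  have hlead : ∀ t ≤ t₀, ∃ (ρ : unitInterval) (m : Multiset (localGraph r).Space),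
      (t : ℝ) / 2 ≤ ρ ∧ (ρ : ℝ) ≤ 1 / 4 ∧ (p t).points = (localGraph r).edgePt i ρ ::ₘ m ∧
      (∀ q ∈ m, radius r ((localGraph r).edgePt i ρ) < radius r q) ∧ branchCount r s m = N := by
    intro t ht
    obtain ⟨ρ, m, h1, h2, h3, h4, h5⟩ := hp t
    have h2' : (ρ : ℝ) ≤ t := h2
    have ht' : (t : ℝ) ≤ 1 / 4 := ht
    refine ⟨ρ, m, h1, h2'.trans ht', h3, fun q hq => ?_, h5⟩
    rw [radius_edgePt]
    have := h4 q hq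
    change (ρ : ℝ) < radius r q
    linarith
  rw [hH p t₀]
  · obtain ⟨ρ, m, h1, h2, h3, h4, h5⟩ := hlead t₀ le_rfl
    have h1' : (1 / 4 : ℝ) / 2 ≤ ρ := h1
    have hρ0 : ρ ≠ 0 := by
      rintro rfl
      norm_num at h1'
    have hρ1 : ρ ≠ 1 := by
      rintro rfl
      norm_num at h2
    rw [leadCocycle_eq r s f (i := i) ⟨_, m, h3, edgePt_mem_openEdge r hρ0 hρ1, h4⟩, h3, ← h5]
    congr 1
    -- The moving particle, being off the center, lies in the same branch as the end of its edge.
    simp only [branchCount, Multiset.countP_cons, ← Multiset.cons_zero, Multiset.countP_zero,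
      edgePt_mem_branch hρ0, edgePt_mem_branch one_ne_zero, zero_add]
  · obtain ⟨ρ, m, h1, h2, h3, -⟩ := hp 0
    have hρ : ρ = 0 := le_antisymm h2 unitInterval.nonneg'
    rw [p.source, hρ, edgePt_zero] at h3
    exact fun h => h (h3 ▸ Multiset.mem_cons_self _ _)
  · intro t ht
    obtain ⟨ρ, m, h1, h2, h3, h4, h5⟩ := hlead t ht
    refine ⟨_, m, h3, ?_, h4⟩
    rw [radius_edgePt]
    change (ρ : ℝ) < 1
    linarith
  · intro t ht
    obtain ⟨ρ, m, h1, h2, h3, h4, h5⟩ := hp t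
    have ht' : (1 / 4 : ℝ) ≤ t := ht
    intro h
    rw [h3, Multiset.mem_cons] at h
    rcases h with h | h
    · have : ρ = 0 := by rw [← radius_edgePt r i ρ, ← h, radius_vertex_none]
      rw [this] at h1
      norm_num at h1
      linarith
    · have := h4 _ h
      rw [radius_vertex_none] at this
      norm_num at this

end LocalHolonomy

end CellGraph

/-! ### Holonomy of maps from the circle -/

section CircleLoops

theorem circleMap_coe {X : Type u} [TopologicalSpace X] {x : X} (p : Path x x)
    (t : unitInterval) : CellGraph.circleMap p ((t : ℝ) : UnitAddCircle) = p t := by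
  change AddCircle.liftIco 1 0 p.extend ((t : ℝ) : UnitAddCircle) = p t
  by_cases h : t = 1
  · subst h
    have : (((1 : unitInterval) : ℝ) : UnitAddCircle) = ((0 : ℝ) : UnitAddCircle) := by
      simp
    rw [this, AddCircle.liftIco_coe_apply (by simp)]
    simp
  · rw [AddCircle.liftIco_coe_apply]
    · exact p.extend_apply t.2
    · exact ⟨t.2.1, by simpa using unitInterval.lt_one_iff_ne_one.2 h⟩

/-- The holonomy along the standard loop of a map from the circle. -/
noncomputable def Holonomy.loop {X : Type u} [TopologicalSpace X] {G : Type v} [Group G]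
    (H : Holonomy X G) (g : C(UnitAddCircle, X)) : G :=
  H.along (CellGraph.circleLoop.map g.continuous)

variable {X : Type u} [TopologicalSpace X] {Y : Type w} [TopologicalSpace Y] {G : Type v} [Group G]
  (H : Holonomy X G)

theorem Holonomy.loop_comp_circleMap (f : C(Y, X)) {y : Y} (p : Path y y) :
    H.loop (f.comp (CellGraph.circleMap p)) = (H.pullback f).along p :=
  H.along_congr fun t => congrArg f (circleMap_coe p t)

theorem Holonomy.loop_const (x : X) : H.loop (ContinuousMap.const _ x) = 1 := by
  rw [← H.along_refl x]
  exact H.along_congr fun t => rfl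

end CircleLoops

/-! ### Decomposition of `ε` into half motions -/

namespace CellGraph

theorem lift_edgePt {V : Type u} {E : Type v} (Γ : CellGraph V E) {Y : Type w} [TopologicalSpace Y]
    (f : V → Y) (g : E → C(unitInterval, Y)) (h0 : ∀ e, g e 0 = f (Γ.src e))
    (h1 : ∀ e, g e 1 = f (Γ.tgt e)) (e : E) (t : unitInterval) :
    Γ.lift f g h0 h1 (Γ.edgePt e t) = g e t := by
  by_cases ht0 : t = 0
  · subst ht0; rw [edgePt_zero, h0]; rfl
  by_cases ht1 : t = 1
  · subst ht1; rw [edgePt_one, h1]; rfl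
  obtain ⟨s, rfl⟩ := exists_toI ht0 ht1
  rw [edgePt_toI]; rfl

theorem starInclusion_edgePt {I : Type u} {J : Type v} (f : I → J) (i : I) (t : unitInterval) :
    starInclusion f ((star I).edgePt i t) = (star J).edgePt (f i) t :=
  lift_edgePt _ _ _ _ _ _ _

theorem leaf_ne_ray {k i : Fin 3} (h : k ≠ i) (t : unitInterval) : leaf k ≠ ray i t := by
  have h1 : ray i t ∈ range (legPath i i) := by
    rw [legPath, Path.trans_range]
    exact Or.inr ⟨t, rfl⟩
  obtain ⟨s, hs⟩ := h1
  rw [← hs]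
  exact legPath_ne_leaf h h s

/-- The path of configurations in which one particle rests at the `k`th leaf, while the other moves
from the central vertex to the `i`th leaf. -/
noncomputable def halfPath (k i : Fin 3) (h : k ≠ i) :
    Path (UConf.mk (pairConf (p := leaf k) (q := ray i 0) (leaf_ne_ray h 0)) :
      B 2 (star (Fin 3)).Space ∅) (pair h) where
  toFun t := UConf.mk (pairConf (leaf_ne_ray h t))
  continuous_toFun := UConf.continuous_mk.comp <| Conf.continuous_of_eval fun a => by
    fin_cases a
    · exact continuous_const
    · exact (ray i).continuous
  source' := rfl
  target' := by
    congr 1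
    exact Subtype.ext (by simp [pairConf])

theorem mk_pairConf_congr {X : Type u} [TopologicalSpace X] {p q q' : X} (h : p ≠ q) (h' : p ≠ q')
    (e : q = q') : (UConf.mk (pairConf h) : B 2 X ∅) = UConf.mk (pairConf h') := by
  subst e; rfl

/-- All half motions with the same resting particle start at one configuration, whatever edge is
taken, which makes them composable after reversal. -/
theorem center_eq (k i j : Fin 3) (hi : k ≠ i) (hj : k ≠ j) :
    (UConf.mk (pairConf (p := leaf k) (q := ray i 0) (leaf_ne_ray hi 0)) :
      B 2 (star (Fin 3)).Space ∅) =
    UConf.mk (pairConf (p := leaf k) (q := ray j 0) (leaf_ne_ray hj 0)) :=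
  mk_pairConf_congr _ _ ((ray i).source.trans (ray j).source.symm)

variable {G : Type u} [Group G] (H : Holonomy (B 2 (star (Fin 3)).Space ∅) G)

/-- The moving particle first runs through its half motion on edge `i` backwards, and then through
that on edge `j`. -/
theorem along_pairPath (k i j : Fin 3) (hi : k ≠ i) (hj : k ≠ j) :
    H.along (pairPath k i j hi hj) =
      H.along (halfPath k j hj) * (H.along (halfPath k i hi))⁻¹ := by
  have h : H.along (halfPath k j hj) =
      H.along ((halfPath k j hj).cast (center_eq k i j hi hj) rfl) := H.along_congr fun _ => rfl
  rw [h, ← H.along_symm, ← H.along_trans]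
  refine H.along_congr fun t => ?_
  change UConf.mk (pairConf (legPath_ne_leaf hi hj t)) = _
  rw [Path.trans_apply]
  split_ifs with ht
  · exact mk_pairConf_congr _ _ (by rw [legPath, Path.trans_apply, dif_pos ht, Path.symm_apply]; rfl)
  · exact mk_pairConf_congr _ _ (by rw [legPath, Path.trans_apply, dif_neg ht])

/-- Holonomy composes from right to left, so the first leg of the loop, with a particle resting at
leaf `0`, is the last factor. -/
theorem along_epsilonPath : H.along epsilonPath =
    H.along (halfPath 1 0 (by decide)) * (H.along (halfPath 1 2 (by decide)))⁻¹ *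
    (H.along (halfPath 2 1 (by decide)) * (H.along (halfPath 2 0 (by decide)))⁻¹) *
    (H.along (halfPath 0 2 (by decide)) * (H.along (halfPath 0 1 (by decide)))⁻¹) := by
  rw [epsilonPath, H.along_trans, H.along_trans, ← along_pairPath, ← along_pairPath,
    ← along_pairPath]
  exact congrArg₂ _ (congrArg₂ _ (H.along_congr fun _ => rfl) (H.along_congr fun _ => rfl)) rfl

theorem points_halfPath (k i : Fin 3) (h : k ≠ i) (t : unitInterval) :
    (halfPath k i h t).points =
      (star (Fin 3)).edgePt i t ::ₘ (star (Fin 3)).edgePt k 1 ::ₘ 0 := by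
  rw [star_edgePt_one]
  exact Multiset.cons_swap (leaf k) (ray i t) 0

/-- Averaging with the predecessor, or with `0`, at worst halves the coordinate of the moving
particle and never increases it. The resting particle and the new one are averages involving `1`,
unless the resting one stays at its leaf, and so remain at distance at least `1/2`. These are the
bounds required by `exists_localHolonomy`. -/
theorem points_edgeStab_halfPath (a k i : Fin 3) (h : k ≠ i) (t : unitInterval) :
    ∃ ρ u u' : unitInterval, (t : ℝ) / 2 ≤ ρ ∧ ρ ≤ t ∧ (1 / 2 : ℝ) ≤ u ∧ (1 / 2 : ℝ) ≤ u' ∧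
      (edgeStab a 2 (halfPath k i h t)).points = (star (Fin 3)).edgePt i ρ ::ₘ
        (star (Fin 3)).edgePt k u ::ₘ (star (Fin 3)).edgePt a u' ::ₘ 0 := by
  set x := (pairConf (leaf_ne_ray h t)).1 with hx
  have hx0 : x 0 = (star (Fin 3)).edgePt k 1 := (star_edgePt_one k).symm
  have hx1 : x 1 = (star (Fin 3)).edgePt i t := rfl
  have hpts : (edgeStab a 2 (halfPath k i h t)).points =
      stabTuple a x (some 1) ::ₘ stabTuple a x (some 0) ::ₘ stabTuple a x none ::ₘ 0 := by
    change (UConf.reindex (finSuccEquiv 2)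
      (UConf.mk (confStab a (pairConf (leaf_ne_ray h t))))).points = _
    rw [UConf.points_reindex, UConf.points_mk]
    change Multiset.map (stabTuple a x) _ = _
    have : (Finset.univ : Finset (Option (Fin 2))).val = some 1 ::ₘ some 0 ::ₘ none ::ₘ 0 := by
      decide
    rw [this]
    rfl
  have h1 : ∃ ρ : unitInterval, (t : ℝ) / 2 ≤ ρ ∧ ρ ≤ t ∧
      stabTuple a x (some 1) = (star (Fin 3)).edgePt i ρ := by
    by_cases hr : x 1 ∈ range ((star (Fin 3)).edgePt a)
    · by_cases hi : i = a
      · subst hi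
        refine ⟨avg (predCoord i x 1) (coord i (x 1)), ?_, ?_, ?_⟩
        · have := (predCoord i x 1).2.1
          change (t : ℝ) / 2 ≤ ((predCoord i x 1 : ℝ) + coord i (x 1)) / 2
          rw [hx1, coord_edgePt]
          linarith
        · have : (predCoord i x 1 : ℝ) ≤ coord i (x 1) := predCoord_le i x 1
          rw [hx1, coord_edgePt] at this
          change ((predCoord i x 1 : ℝ) + coord i (x 1)) / 2 ≤ (t : ℝ)
          rw [hx1, coord_edgePt]
          linarith
        · simp only [stabTuple, if_pos hr]
      -- Distinct edges meet only in the central vertex, where stabilization fixes the particle.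
      · have ht : t = 0 := by
          obtain ⟨s, hs⟩ := hr
          have h2 := congrArg (coord i) hs
          rw [hx1, coord_edgePt_of_ne a hi, coord_edgePt] at h2
          exact h2.symm
        subst ht
        refine ⟨0, by simp, le_rfl, ?_⟩
        have hc : coord a (x 1) = 0 := by
          rw [hx1, coord_edgePt_of_ne i (Ne.symm hi)]
        have hp : predCoord a x 1 = 0 :=
          le_antisymm (hc ▸ predCoord_le a x 1) unitInterval.nonneg'
        simp only [stabTuple, if_pos hr, hc, hp]
        rw [star_edgePt_zero, ← star_edgePt_zero a]
        congr 1
        exact Subtype.ext (by simp [avg])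
    · refine ⟨t, ?_, le_rfl, ?_⟩
      · have := t.2.1
        linarith
      · simp only [stabTuple, if_neg hr, hx1]
  have h0 : ∃ u : unitInterval, (1 / 2 : ℝ) ≤ u ∧
      stabTuple a x (some 0) = (star (Fin 3)).edgePt k u := by
    by_cases hr : x 0 ∈ range ((star (Fin 3)).edgePt a)
    · have hk : k = a := by
        by_contra hk
        obtain ⟨s, hs⟩ := hr
        have h2 := congrArg (coord k) hs
        rw [hx0, coord_edgePt_of_ne a hk, coord_edgePt] at h2
        exact zero_ne_one h2
      subst hk
      refine ⟨avg (predCoord k x 0) (coord k (x 0)), ?_, ?_⟩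
      · have := (predCoord k x 0).2.1
        change (1 / 2 : ℝ) ≤ ((predCoord k x 0 : ℝ) + coord k (x 0)) / 2
        rw [hx0, coord_edgePt]
        change (1 / 2 : ℝ) ≤ ((predCoord k x 0 : ℝ) + (1 : ℝ)) / 2
        linarith
      · simp only [stabTuple, if_pos hr]
    · refine ⟨1, by norm_num, ?_⟩
      simp only [stabTuple, if_neg hr, hx0]
  obtain ⟨ρ, hρ, hρ', e1⟩ := h1
  obtain ⟨u, hu, e0⟩ := h0
  refine ⟨ρ, u, avg (lastCoord a x) 1, hρ, hρ', hu, ?_, ?_⟩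
  · have := (lastCoord a x).2.1
    change (1 / 2 : ℝ) ≤ ((lastCoord a x : ℝ) + (1 : ℝ)) / 2
    linarith
  · rw [hpts, e1, e0]
    rfl

end CellGraph

/-! ### A Heisenberg group of permutations -/

section Permutations

/-- Translation of `ℤ × ℤ` in the first coordinate. -/
def translation : Equiv.Perm (ℤ × ℤ) := Equiv.addRight (1, 0)

/-- Translation of `ℤ × ℤ` in the second coordinate. -/
def centralTranslation : Equiv.Perm (ℤ × ℤ) := Equiv.addRight (0, 1)

/-- The shear of `ℤ × ℤ`. -/
def shear : Equiv.Perm (ℤ × ℤ) where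
  toFun p := (p.1, p.2 + p.1)
  invFun p := (p.1, p.2 - p.1)
  left_inv p := by simp
  right_inv p := by simp

theorem centralTranslation_zpow_apply (n : ℤ) (p : ℤ × ℤ) :
    (centralTranslation ^ n) p = (p.1, p.2 + n) := by
  have h : ∀ q, centralTranslation q = (q.1 + 0, q.2 + 1) := fun _ => rfl
  have h' : ∀ q, centralTranslation⁻¹ q = (q.1 + -0, q.2 + -1) := fun _ => rfl
  induction n using Int.induction_on generalizing p with
  | zero => simp
  | succ n ih =>
    rw [zpow_add_one, Equiv.Perm.mul_apply, ih, h]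
    ext
    · simp
    · simp only
      ring
  | pred n ih =>
    rw [zpow_sub_one, Equiv.Perm.mul_apply, ih, h']
    ext
    · simp
    · simp only
      ring

theorem centralTranslation_zpow_eq_one {n : ℤ} (h : centralTranslation ^ n = 1) : n = 0 := by
  have := congrArg (fun σ : Equiv.Perm (ℤ × ℤ) => (σ 0).2) h
  simpa [centralTranslation_zpow_apply] using this

/-- The holonomy of the loop `ε`, if those of the half edges depend on the moving particle only. -/
def epsilonWord {G : Type u} [Group G] (x y z : G) : G :=
  x * z⁻¹ * (y * x⁻¹) * (z * y⁻¹)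

/-- This makes `φ¹` invisible to a weight with equal values on the last two of its three edges. -/
theorem epsilonWord_degenerate {G : Type u} [Group G] (x y : G) : epsilonWord x y y = 1 := by
  simp [epsilonWord]

/-- With one weight trivial the word is a commutator, and the translation and the shear commute up
to a central element of infinite order. -/
theorem epsilonWord_eq : epsilonWord 1 translation shear = centralTranslation⁻¹ := by
  have h : epsilonWord 1 translation shear =
      shear⁻¹ * translation * shear * translation⁻¹ := by
    simp [epsilonWord, mul_assoc]
  rw [h]
  ext1 p
  have hs : ∀ q, shear⁻¹ q = (q.1, q.2 - q.1) := fun _ => rfl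
  have hs' : ∀ q, shear q = (q.1, q.2 + q.1) := fun _ => rfl
  have ht : ∀ q, translation q = (q.1 + 1, q.2 + 0) := fun _ => rfl
  have ht' : ∀ q, translation⁻¹ q = (q.1 + -1, q.2 + -0) := fun _ => rfl
  have hc : ∀ q, centralTranslation⁻¹ q = (q.1 + -0, q.2 + -1) := fun _ => rfl
  simp only [Equiv.Perm.mul_apply, hs, hs', ht, ht', hc]
  ext
  · simp
  · simp only [add_zero, neg_zero]
    ring

end Permutations

/-! ### Separating `φ⁰` from `φ¹` at a single vertex -/

namespace CellGraph

section LocalSeparation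

variable {I : Type u} {r : Setoid I} {n k : ℕ} {o : Fin n → I}
  {e : C((star (Fin n)).Space, (localGraph r).Space)}
  {T : Multiset (localGraph r).Space}

theorem branchCount_cons (s : Quotient r) (p : (localGraph r).Space)
    (m : Multiset (localGraph r).Space) :
    branchCount r s (p ::ₘ m) = branchCount r s m + branchCount r s {p} := by
  classical
  simp only [branchCount, Multiset.countP_cons, ← Multiset.cons_zero, Multiset.countP_zero,
    zero_add]

theorem branchCount_edgePt (s : Quotient r) (i : I) {t : unitInterval} (ht : t ≠ 0) :
    branchCount r s {(localGraph r).edgePt i t} =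
      branchCount r s {(localGraph r).edgePt i 1} := by
  classical
  simp only [branchCount, ← Multiset.cons_zero, Multiset.countP_cons, edgePt_mem_branch ht,
    edgePt_mem_branch one_ne_zero]

theorem branchCount_edgePt_eq_one {s : Quotient r} {i : I} (h : Quotient.mk r i = s) :
    branchCount r s {(localGraph r).edgePt i 1} = 1 := by
  classical
  simp [branchCount, ← Multiset.cons_zero, edgePt_mem_branch, h]

theorem branchCount_edgePt_eq_zero {s : Quotient r} {i : I} (h : Quotient.mk r i ≠ s) :
    branchCount r s {(localGraph r).edgePt i 1} = 0 := by
  classical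
  simp [branchCount, ← Multiset.cons_zero, edgePt_mem_branch, h]

theorem ne_zero_of_half_le {t : unitInterval} (h : (1 / 2 : ℝ) ≤ t) : t ≠ 0 := by
  rintro rfl
  norm_num at h

/-- The holonomy of `ε` in the configuration space of a local graph, weighted by the edge along
which the central vertex is approached. -/
theorem exists_holonomy_epsilon
    (he : ∀ i t, e ((star (Fin n)).edgePt i t) = (localGraph r).edgePt (o i) t)
    (hT : ∀ q ∈ T, radius r q = 1)
    (L : C(B 2 (star (Fin n)).Space ∅, B k (localGraph r).Space (localSinks r)))
    (hL : ∀ y, (L y).points = y.points.map e + T) (s : Quotient r)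
    {F : Type w} [TopologicalSpace F] [DiscreteTopology F] (f : I → Equiv.Perm F) :
    ∃ H : Holonomy (B k (localGraph r).Space (localSinks r)) (Equiv.Perm F),
      ∀ (a : ℕ) (ha : a + 3 ≤ n), H.loop (L.comp ((iota 2 a n ha).comp epsilon)) =
        epsilonWord (f (o ⟨a, by omega⟩)) (f (o ⟨1 + a, by omega⟩)) (f (o ⟨2 + a, by omega⟩)) := by
  obtain ⟨H, hH⟩ := exists_localHolonomy r s (fun i _ => f i) k
  refine ⟨H, fun a ha => ?_⟩
  have key : ∀ (j i : Fin 3) (h : j ≠ i),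
      (H.pullback (L.comp (iota 2 a n ha))).along (halfPath j i h) = f (o ⟨i + a, by omega⟩) := by
    intro j i h
    rw [Holonomy.pullback_along]
    refine hH _ _ (branchCount r s ((localGraph r).edgePt (o ⟨j + a, by omega⟩) 1 ::ₘ T))
      fun t => ⟨t, (localGraph r).edgePt (o ⟨j + a, by omega⟩) 1 ::ₘ T, ?_, le_rfl, ?_, ?_, rfl⟩
    · have := t.2.1
      linarith
    · change (L (iota 2 a n ha (halfPath j i h t))).points = _
      rw [hL, iota, UConf.points_map, points_halfPath]
      simp only [Multiset.map_cons, Multiset.map_zero, starInclusion_edgePt, he,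
        Multiset.cons_add, zero_add]
    · intro q hq
      rcases Multiset.mem_cons.1 hq with rfl | hq
      · rw [radius_edgePt]; norm_num
      · rw [hT q hq]; norm_num
  rw [← ContinuousMap.comp_assoc, epsilon, Holonomy.loop_comp_circleMap, along_epsilonPath]
  simp only [key, epsilonWord]
  simp

/-- The holonomy of `σ ∘ ε` in the configuration space of a local graph, weighted by the edge along
which the central vertex is approached and by the number of particles in a branch. -/
theorem exists_holonomy_edgeStab_epsilon
    (he : ∀ i t, e ((star (Fin n)).edgePt i t) = (localGraph r).edgePt (o i) t)
    (hT : ∀ q ∈ T, radius r q = 1) (hn : 0 + 3 ≤ n)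
    (L : C(B 3 (star (Fin n)).Space ∅, B k (localGraph r).Space (localSinks r)))
    (hL : ∀ y, (L y).points = y.points.map e + T) (s : Quotient r)
    {F : Type w} [TopologicalSpace F] [DiscreteTopology F] (f : I → ℕ → Equiv.Perm F) :
    ∃ H : Holonomy (B k (localGraph r).Space (localSinks r)) (Equiv.Perm F), ∀ (a : Fin 3),
      ∃ g : Fin 3 → Fin 3 → Equiv.Perm F,
        (∀ j i, g j i = f (o ⟨i, by omega⟩) (branchCount r s T +
          branchCount r s {(localGraph r).edgePt (o ⟨a, by omega⟩) 1} +
          branchCount r s {(localGraph r).edgePt (o ⟨j, by omega⟩) 1} +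
          branchCount r s {(localGraph r).edgePt (o ⟨i, by omega⟩) 1})) ∧
        H.loop (L.comp ((iota 3 0 n hn).comp ((edgeStab a 2).comp epsilon))) =
          g 1 0 * (g 1 2)⁻¹ * (g 2 1 * (g 2 0)⁻¹) * (g 0 2 * (g 0 1)⁻¹) := by
  obtain ⟨H, hH⟩ := exists_localHolonomy r s f k
  refine ⟨H, fun a => ⟨_, fun _ _ => rfl, ?_⟩⟩
  have key : ∀ (j i : Fin 3) (h : j ≠ i),
      (H.pullback ((L.comp (iota 3 0 n hn)).comp (edgeStab a 2))).along (halfPath j i h) =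
        f (o ⟨i, by omega⟩) (branchCount r s T +
          branchCount r s {(localGraph r).edgePt (o ⟨a, by omega⟩) 1} +
          branchCount r s {(localGraph r).edgePt (o ⟨j, by omega⟩) 1} +
          branchCount r s {(localGraph r).edgePt (o ⟨i, by omega⟩) 1}) := by
    intro j i h
    rw [Holonomy.pullback_along]
    refine hH _ _ _ fun t => ?_
    obtain ⟨ρ, u, u', hρ, hρ', hu, hu', hp⟩ := points_edgeStab_halfPath a j i h t
    refine ⟨ρ, (localGraph r).edgePt (o ⟨j, by omega⟩) u ::ₘ
      (localGraph r).edgePt (o ⟨a, by omega⟩) u' ::ₘ T, hρ, hρ', ?_, ?_, ?_⟩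
    · change (L (iota 3 0 n hn (edgeStab a 2 (halfPath j i h t)))).points = _
      rw [hL, iota, UConf.points_map, hp]
      simp only [Multiset.map_cons, Multiset.map_zero, starInclusion_edgePt, he,
        Multiset.cons_add, zero_add, add_zero]
    · intro q hq
      rcases Multiset.mem_cons.1 hq with rfl | hq
      · rwa [radius_edgePt]
      rcases Multiset.mem_cons.1 hq with rfl | hq
      · rwa [radius_edgePt]
      · rw [hT q hq]; norm_num
    · rw [branchCount_cons, branchCount_cons, branchCount_edgePt s _ (ne_zero_of_half_le hu),
        branchCount_edgePt s _ (ne_zero_of_half_le hu')]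
  rw [← ContinuousMap.comp_assoc, ← ContinuousMap.comp_assoc, epsilon,
    Holonomy.loop_comp_circleMap, along_epsilonPath]
  simp only [key]

/-- Holonomies in the configuration space of a local graph detect the loops `φ^0` and `φ^1`, and
tell their powers apart. -/
theorem exists_holonomy_phi (hn : 3 ≤ n) (ho : Function.Injective o)
    (he : ∀ i t, e ((star (Fin n)).edgePt i t) = (localGraph r).edgePt (o i) t)
    (hT : ∀ q ∈ T, radius r q = 1) (c : VertexType) (hc : c = .high → 4 ≤ n)
    (hsep : c = .separatingTrivalent → ¬ r (o ⟨0, by omega⟩) (o ⟨1, by omega⟩))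
    (L : C(B c.size (star (Fin n)).Space ∅, B k (localGraph r).Space (localSinks r)))
    (hL : ∀ y, (L y).points = y.points.map e + T) :
    (∃ H : Holonomy (B k (localGraph r).Space (localSinks r)) (Equiv.Perm (ℤ × ℤ)),
      (∀ m : ℤ, H.loop (L.comp (phi 0 n hn c hc)) ^ m = 1 → m = 0) ∧
        H.loop (L.comp (phi 1 n hn c hc)) = 1) ∧
    (c ≠ .nonseparatingTrivalent →
      ∃ H : Holonomy (B k (localGraph r).Space (localSinks r)) (Equiv.Perm (ℤ × ℤ)),
        ∀ m : ℤ, H.loop (L.comp (phi 1 n hn c hc)) ^ m = 1 → m = 0) := by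
  classical
  have hne : ∀ (i j : ℕ) (hi : i < n) (hj : j < n), i ≠ j → o ⟨i, hi⟩ ≠ o ⟨j, hj⟩ :=
    fun i j hi hj h h' => h (congrArg Fin.val (ho h'))
  set s : Quotient r := Quotient.mk r (o ⟨0, by omega⟩) with hs
  set f : I → Equiv.Perm (ℤ × ℤ) := fun i =>
    if i = o ⟨0, by omega⟩ then 1 else if i = o ⟨1, by omega⟩ then translation else shear with hf
  have hinv : ∀ m : ℤ, (centralTranslation⁻¹) ^ m = 1 → m = 0 := fun m hm =>
    centralTranslation_zpow_eq_one (by rwa [inv_zpow, inv_eq_one] at hm)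
  cases c with
  | high =>
    have hn4 := hc rfl
    refine ⟨?_, fun _ => ?_⟩
    · obtain ⟨H, hH⟩ := exists_holonomy_epsilon he hT L hL s f
      refine ⟨H, ?_, ?_⟩
      · have h := hH 0 (by omega)
        have h' : H.loop (L.comp (phi 0 n hn .high hc)) = centralTranslation⁻¹ := by
          refine h.trans ?_
          rw [← epsilonWord_eq]
          simp only [hf, if_true, add_zero, if_neg (hne 1 0 (by omega) (by omega) (by omega)),
            if_neg (hne 2 0 (by omega) (by omega) (by omega)),
            if_neg (hne 2 1 (by omega) (by omega) (by omega))]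
        rw [h']
        exact hinv
      -- The edges are now the second to the fourth, with weights translation, shear, shear, so the
      -- word degenerates.
      · refine (hH 1 (by omega)).trans ?_
        simp only [hf, Nat.reduceAdd, if_neg (hne 2 0 (by omega) (by omega) (by omega)),
          if_neg (hne 2 1 (by omega) (by omega) (by omega)),
          if_neg (hne 3 0 (by omega) (by omega) (by omega)),
          if_neg (hne 3 1 (by omega) (by omega) (by omega)), epsilonWord_degenerate]
    -- The same weights shifted by one edge detect `φ¹`.
    · obtain ⟨H, hH⟩ := exists_holonomy_epsilon he hT L hL s (fun i =>
        if i = o ⟨1, by omega⟩ then 1 else if i = o ⟨2, by omega⟩ then translation else shear)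
      refine ⟨H, ?_⟩
      have h' : H.loop (L.comp (phi 1 n hn .high hc)) = centralTranslation⁻¹ := by
        refine (hH 1 (by omega)).trans ?_
        rw [← epsilonWord_eq]
        simp only [Nat.reduceAdd, if_true, if_neg (hne 2 1 (by omega) (by omega) (by omega)),
          if_neg (hne 3 1 (by omega) (by omega) (by omega)),
          if_neg (hne 3 2 (by omega) (by omega) (by omega))]
      rw [h']
      exact hinv
  | nonseparatingTrivalent =>
    refine ⟨?_, fun h => absurd rfl h⟩
    obtain ⟨H, hH⟩ := exists_holonomy_epsilon he hT L hL s f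
    refine ⟨H, ?_, ?_⟩
    · have h' : H.loop (L.comp (phi 0 n hn .nonseparatingTrivalent hc)) =
          centralTranslation⁻¹ := by
        refine (hH 0 (by omega)).trans ?_
        rw [← epsilonWord_eq]
        simp only [hf, if_true, add_zero, if_neg (hne 1 0 (by omega) (by omega) (by omega)),
          if_neg (hne 2 0 (by omega) (by omega) (by omega)),
          if_neg (hne 2 1 (by omega) (by omega) (by omega))]
      rw [h']
      exact hinv
    · exact H.loop_const (L (iota 2 0 n (by omega) (pair (i := 0) (j := 1) (by decide))))
  | separatingTrivalent =>
    have h0 : branchCount r s {(localGraph r).edgePt (o ⟨0, by omega⟩) 1} = 1 :=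
      branchCount_edgePt_eq_one rfl
    have h1 : branchCount r s {(localGraph r).edgePt (o ⟨1, by omega⟩) 1} = 0 :=
      branchCount_edgePt_eq_zero fun h => hsep rfl (Setoid.symm (Quotient.exact h))
    -- The third edge may or may not lie in the branch of the first; its contribution is common to
    -- all counts below and is absorbed into `N`, as are the particles at the other stars.
    set N := branchCount r s T + branchCount r s {(localGraph r).edgePt (o ⟨2, by omega⟩) 1} with hN
    -- With weight only on the third edge, the word reduces to `(g 1 2)⁻¹ * g 0 2`. The two counts
    -- differ by one, since leaf `0` is in the branch and leaf `1` is not; stabilizing on the first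
    -- edge raises both by one compared with the second.
    have main : ∀ M : ℕ, ∃ H : Holonomy (B k (localGraph r).Space (localSinks r))
        (Equiv.Perm (ℤ × ℤ)),
        H.loop (L.comp (phi 0 n hn .separatingTrivalent hc)) =
          (if N + 1 = M then centralTranslation else 1)⁻¹ *
            (if N + 2 = M then centralTranslation else 1) ∧
        H.loop (L.comp (phi 1 n hn .separatingTrivalent hc)) =
          (if N = M then centralTranslation else 1)⁻¹ *
            (if N + 1 = M then centralTranslation else 1) := by
      intro M
      obtain ⟨H, hH⟩ := exists_holonomy_edgeStab_epsilon he hT (by omega) L hL s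
        (fun i m => if i = o ⟨2, by omega⟩ ∧ m = M then centralTranslation else 1)
      refine ⟨H, ?_, ?_⟩
      · obtain ⟨g, hg, h⟩ := hH 0
        refine h.trans ?_
        have z : ∀ j i : Fin 3, (i : ℕ) ≠ 2 → g j i = 1 := fun j i hi => by
          rw [hg, if_neg fun h => hne _ _ _ _ hi h.1]
        have g1 : g 1 2 = if N + 1 = M then centralTranslation else 1 := by
          refine (hg 1 2).trans ?_
          change (if o ⟨2, _⟩ = o ⟨2, _⟩ ∧ branchCount r s T +
            branchCount r s {(localGraph r).edgePt (o ⟨0, by omega⟩) 1} +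
            branchCount r s {(localGraph r).edgePt (o ⟨1, by omega⟩) 1} +
            branchCount r s {(localGraph r).edgePt (o ⟨2, by omega⟩) 1} = M then _ else _) = _
          rw [h0, h1, hN]
          simp only [true_and, add_zero, add_right_comm]
        have g0 : g 0 2 = if N + 2 = M then centralTranslation else 1 := by
          refine (hg 0 2).trans ?_
          change (if o ⟨2, _⟩ = o ⟨2, _⟩ ∧ branchCount r s T +
            branchCount r s {(localGraph r).edgePt (o ⟨0, by omega⟩) 1} +
            branchCount r s {(localGraph r).edgePt (o ⟨0, by omega⟩) 1} +
            branchCount r s {(localGraph r).edgePt (o ⟨2, by omega⟩) 1} = M then _ else _) = _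
          rw [h0, hN]
          simp only [true_and, add_right_comm]
        rw [z 1 0 (by decide), z 2 1 (by decide), z 2 0 (by decide), z 0 1 (by decide), g1, g0]
        simp
      · obtain ⟨g, hg, h⟩ := hH 1
        refine h.trans ?_
        have z : ∀ j i : Fin 3, (i : ℕ) ≠ 2 → g j i = 1 := fun j i hi => by
          rw [hg, if_neg fun h => hne _ _ _ _ hi h.1]
        have g1 : g 1 2 = if N = M then centralTranslation else 1 := by
          refine (hg 1 2).trans ?_
          change (if o ⟨2, _⟩ = o ⟨2, _⟩ ∧ branchCount r s T +
            branchCount r s {(localGraph r).edgePt (o ⟨1, by omega⟩) 1} +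
            branchCount r s {(localGraph r).edgePt (o ⟨1, by omega⟩) 1} +
            branchCount r s {(localGraph r).edgePt (o ⟨2, by omega⟩) 1} = M then _ else _) = _
          rw [h1, hN]
          simp only [true_and, add_zero]
        have g0 : g 0 2 = if N + 1 = M then centralTranslation else 1 := by
          refine (hg 0 2).trans ?_
          change (if o ⟨2, _⟩ = o ⟨2, _⟩ ∧ branchCount r s T +
            branchCount r s {(localGraph r).edgePt (o ⟨1, by omega⟩) 1} +
            branchCount r s {(localGraph r).edgePt (o ⟨0, by omega⟩) 1} +
            branchCount r s {(localGraph r).edgePt (o ⟨2, by omega⟩) 1} = M then _ else _) = _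
          rw [h0, h1, hN]
          simp only [true_and, add_zero, add_right_comm]
        rw [z 1 0 (by decide), z 2 1 (by decide), z 2 0 (by decide), z 0 1 (by decide), g1, g0]
        simp
    refine ⟨?_, fun _ => ?_⟩
    -- The counts are `N + 1`, `N + 2` for `φ⁰` and `N`, `N + 1` for `φ¹`, so `N + 2` occurs for the
    -- former only.
    · obtain ⟨H, e0, e1⟩ := main (N + 2)
      refine ⟨H, ?_, ?_⟩
      · rw [e0]
        simpa using fun m => centralTranslation_zpow_eq_one (n := m)
      · rw [e1]
        simp
    -- The count `N` occurs exactly once in the word of `φ¹`, so the powers of its holonomy are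
    -- faithful.
    · obtain ⟨H, e0, e1⟩ := main N
      refine ⟨H, ?_⟩
      rw [e1]
      simpa using fun m => centralTranslation_zpow_eq_one (n := m)

end LocalSeparation

end CellGraph

/-! ### Points of amalgamated configurations -/

section AmalgamatedPoints

set_option linter.unusedSectionVars false

variable {A : Type u} {L : A → Type z} {X : A → Type v} [∀ a, TopologicalSpace (X a)]
  {Y : Type w} [TopologicalSpace Y]

theorem amalgamate_mk [Finite A] (f : ∀ a, C(X a, Y))
    (hf : ∀ a b x y, f a x = f b y → (⟨a, x⟩ : Σ a, X a) = ⟨b, y⟩)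
    (c : ∀ a, Conf (L a) (X a) ∅) :
    UConf.amalgamate L f hf (fun a => UConf.mk (c a)) = UConf.mk (Conf.amalgamate L f hf c) := by
  unfold UConf.amalgamate
  generalize_proofs _ hq _ h
  exact DFunLike.congr_fun (hq.lift_comp _ h) c

theorem exists_conf_eq (z : ∀ a, UConf (L a) (X a) ∅) :
    ∃ c : ∀ a, Conf (L a) (X a) ∅, z = fun a => UConf.mk (c a) := by
  have h : ∀ a, ∃ c : Conf (L a) (X a) ∅, UConf.mk c = z a := fun a => Quotient.exists_rep (z a)
  choose c hc using h
  exact ⟨c, funext fun a => (hc a).symm⟩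

theorem points_amalgamate [Fintype A] [∀ a, Fintype (L a)] (f : ∀ a, C(X a, Y))
    (hf : ∀ a b x y, f a x = f b y → (⟨a, x⟩ : Σ a, X a) = ⟨b, y⟩)
    (z : ∀ a, UConf (L a) (X a) ∅) :
    (UConf.amalgamate L f hf z).points = ∑ a, (z a).points.map (f a) := by
  obtain ⟨c, rfl⟩ := exists_conf_eq z
  rw [amalgamate_mk, UConf.points_mk]
  change Multiset.map _ (Multiset.bind _ _) = _
  rw [Multiset.map_bind]
  change Multiset.sum (Multiset.map _ _) = Multiset.sum (Multiset.map _ _)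
  congr 1
  refine Multiset.map_congr rfl fun a _ => ?_
  rw [Multiset.map_map, UConf.points_mk, Multiset.map_map]
  rfl

end AmalgamatedPoints

/-! ### Reduction of configurations on stars to one local graph -/

namespace CellGraph

section LocalQuotients

set_option linter.unusedSectionVars false

variable {V : Type u} {E : Type v} {Γ : CellGraph V E} [ConnectedSpace Γ.Space]

theorem localQuotient_edgePt (hl : ∀ e, Γ.src e ≠ Γ.tgt e) (x : V) (e : E) (t : unitInterval) :
    Γ.localQuotient hl x (Γ.edgePt e t) = Γ.localQuotientEdge x e t :=
  lift_edgePt _ _ _ _ _ _ _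

theorem starMap_edgePt (x : V) {I : Type w} (o : I → Γ.Incident x) (i : I) (t : unitInterval) :
    Γ.starMap x o ((star I).edgePt i t) = Γ.outward x (o i) t :=
  lift_edgePt _ _ _ _ _ _ _

/-- The orientation of an edge in `Γ` is reversed, if at all, both by the star embedding and by the
quotient map, and so cancels. -/
theorem localQuotient_starMap (hl : ∀ e, Γ.src e ≠ Γ.tgt e) (x : V) {I : Type w}
    (o : I → Γ.Incident x) (i : I) (t : unitInterval) :
    Γ.localQuotient hl x (Γ.starMap x o ((star I).edgePt i t)) =
      (Γ.localGraphAt x).edgePt (o i) t := by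
  rw [starMap_edgePt]
  unfold outward
  split_ifs with h
  · change Γ.localQuotient hl x (Γ.edgePt _ _) = _
    rw [localQuotient_edgePt, localQuotientEdge, dif_pos h]
    rfl
  · change Γ.localQuotient hl x (Γ.edgePt _ (unitInterval.symm t)) = _
    rw [localQuotient_edgePt, localQuotientEdge, dif_neg h, dif_pos ((o i).2.resolve_left h)]
    change (Γ.localGraphAt x).edgePt _ (unitInterval.symm (unitInterval.symm t)) = _
    rw [unitInterval.symm_symm]
    rfl

/-- The closed star of another vertex is sent to a single sink, if disjoint from that of `x`. -/
theorem localQuotient_starMap_of_disjoint (hl : ∀ e, Γ.src e ≠ Γ.tgt e) {x y : V} (hxy : y ≠ x)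
    (hd : Disjoint (Γ.closedStar x) (Γ.closedStar y)) {I : Type w} (o : I → Γ.Incident y)
    (p : (star I).Space) :
    Γ.localQuotient hl x (Γ.starMap y o p) = .vertex (some (Γ.componentClass x (.vertex y)
      fun h => hxy (Space.vertex_injective h))) := by
  have hvert : Γ.localQuotient hl x (.vertex y) = .vertex (some (Γ.componentClass x (.vertex y)
      fun h => hxy (Space.vertex_injective h))) := by
    change Γ.localQuotientVertex x y = _
    rw [localQuotientVertex, dif_neg hxy]
  have hedge : ∀ (e : Γ.Incident y) (t : unitInterval),
      Γ.localQuotient hl x (Γ.edgePt e.1 t) = .vertex (some (Γ.componentClass x (.vertex y)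
        fun h => hxy (Space.vertex_injective h))) := by
    intro e t
    have hmem : ∀ t, Γ.edgePt e.1 t ∈ Γ.closedStar y := fun t =>
      Or.inr (mem_iUnion.2 ⟨e, t, rfl⟩)
    have hx : Space.vertex x ∉ Γ.closedStar y := disjoint_left.1 hd (Or.inl rfl)
    have hs : Γ.src e.1 ≠ x := fun h => hx (by rw [← h, ← edgePt_zero]; exact hmem 0)
    have ht : Γ.tgt e.1 ≠ x := fun h => hx (by rw [← h, ← edgePt_one]; exact hmem 1)
    rw [localQuotient_edgePt, localQuotientEdge, dif_neg hs, dif_neg ht]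
    refine congrArg _ (congrArg _ (Γ.componentClass_congr _ _ ?_))
    rcases e.2 with h | h
    · have hv : Γ.edgePt e.1 0 = .vertex y := by rw [edgePt_zero, h]
      rw [← hv]
      exact (Γ.complComponent_midpoint (fun _ => hs) (fun _ => ht)).symm
    · have hv : Γ.edgePt e.1 1 = .vertex y := by rw [edgePt_one, h]
      rw [← hv]
      exact (Γ.complComponent_midpoint (fun _ => hs) (fun _ => ht)).symm
  have hout : ∀ (i : I) (t : unitInterval), Γ.localQuotient hl x (Γ.outward y (o i) t) =
      .vertex (some (Γ.componentClass x (.vertex y)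
        fun h => hxy (Space.vertex_injective h))) := by
    intro i t
    unfold outward
    split_ifs
    · exact hedge _ _
    · exact hedge _ _
  rcases p with (_ | i) | ⟨i, t⟩
  · exact hvert
  · exact hout i 1
  · exact hout i (toI t)

variable (hΓ : Γ.Subdivided) {W : Finset V} (hW : ∀ x ∈ W, Γ.Essential x)
  (o : ∀ x : W, Fin (Γ.valence x) ≃ Γ.Incident x.1)

/-- The map induced on configuration spaces by the quotient map to a local graph. -/
noncomputable def confQuotient (k : ℕ) (x : V) : C(B k Γ.Space ∅,
    B k (Γ.localGraphAt x).Space (localSinks (Γ.edgeSetoid x))) :=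
  UConf.map (Γ.localQuotient hΓ.loopless x) (Γ.nearMono_localQuotient hΓ.loopless x)

/-- The image of a configuration supported on closed stars in the configuration space of a local
graph does not depend on the particles at other stars. -/
theorem confQuotient_starUnion_congr {x : V} (hx : Γ.Essential x)
    {z z' : ∀ y : W, B (Γ.vertexType y).size (star (Fin (Γ.valence y))).Space ∅}
    (h : ∀ y : W, y.1 = x → z y = z' y) :
    confQuotient hΓ _ x (starUnion hΓ W hW o z) = confQuotient hΓ _ x (starUnion hΓ W hW o z') := by
  classical
  obtain ⟨c, rfl⟩ := exists_conf_eq z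
  obtain ⟨c', rfl⟩ := exists_conf_eq z'
  -- Choosing identical labelled representatives at `x` reduces the claim to an equality of labelled
  -- configurations, checked one particle at a time.
  have hc : (fun y : W => (UConf.mk (c' y) : B (Γ.vertexType y).size _ ∅)) =
      fun y => UConf.mk (if y.1 = x then c y else c' y) := by
    funext y
    split_ifs with hy
    · exact (h y hy).symm
    · rfl
  rw [hc]
  simp only [starUnion, ContinuousMap.comp_apply, amalgamate_mk]
  refine congrArg UConf.mk (Subtype.ext (funext fun j => ?_))
  set p := Γ.labelEquiv W j with hp
  change Γ.localQuotient hΓ.loopless x (Γ.starMap p.1.1 (o p.1) ((c p.1).1 p.2)) =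
    Γ.localQuotient hΓ.loopless x (Γ.starMap p.1.1 (o p.1)
      ((if p.1.1 = x then c p.1 else c' p.1).1 p.2))
  split_ifs with hy
  · rfl
  · have hd := hΓ.disjoint_stars x p.1.1 hx (hW _ p.1.2) (Ne.symm hy)
    rw [localQuotient_starMap_of_disjoint hΓ.loopless hy hd,
      localQuotient_starMap_of_disjoint hΓ.loopless hy hd]

theorem points_confQuotient_starUnion (x : V)
    (z : ∀ y : W, B (Γ.vertexType y).size (star (Fin (Γ.valence y))).Space ∅) :
    (confQuotient hΓ _ x (starUnion hΓ W hW o z)).points =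
      ∑ y : W, (z y).points.map ((Γ.localQuotient hΓ.loopless x).comp (Γ.starMap y.1 (o y))) := by
  rw [confQuotient, UConf.points_map, starUnion, ContinuousMap.comp_apply, UConf.points_reindex,
    points_amalgamate]
  refine (map_sum (Multiset.mapAddMonoidHom _) _ _).trans (Finset.sum_congr rfl fun y _ => ?_)
  exact Multiset.map_map _ _ _

/-- The map to the configuration space of the local graph at a vertex of `W` factors through the
configurations in the star at this vertex, and adds particles at sinks. -/
theorem exists_local_factorization (x : W) :
    ∃ (L : C(B (Γ.vertexType x).size (star (Fin (Γ.valence x))).Space ∅,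
        B (Γ.totalSize W) (Γ.localGraphAt x.1).Space (localSinks (Γ.edgeSetoid x.1))))
      (T : Multiset (Γ.localGraphAt x.1).Space),
      (∀ z, confQuotient hΓ _ x.1 (starUnion hΓ W hW o z) = L (z x)) ∧
      (∀ q ∈ T, radius (Γ.edgeSetoid x.1) q = 1) ∧
      ∀ y, (L y).points =
        y.points.map ((Γ.localQuotient hΓ.loopless x.1).comp (Γ.starMap x.1 (o x))) + T := by
  classical
  -- Any family would do: the positions of particles on other stars do not affect the image.
  let z₀ : ∀ y : W, B (Γ.vertexType y).size (star (Fin (Γ.valence y))).Space ∅ := fun y =>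
    phi 0 (Γ.valence y) (hW _ y.2) (Γ.vertexType y) Γ.four_le_valence 0
  refine ⟨⟨fun y => confQuotient hΓ _ x.1 (starUnion hΓ W hW o (Function.update z₀ x y)), ?_⟩,
    ∑ y ∈ Finset.univ.erase x, (z₀ y).points.map
      ((Γ.localQuotient hΓ.loopless x.1).comp (Γ.starMap y.1 (o y))), fun z => ?_, fun q hq => ?_,
    fun y => ?_⟩
  · exact (confQuotient hΓ _ x.1).continuous.comp ((starUnion hΓ W hW o).continuous.comp
      (continuous_const.update x continuous_id))
  · refine confQuotient_starUnion_congr hΓ hW o (hW _ x.2) fun y hy => ?_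
    obtain rfl : y = x := Subtype.ext hy
    simp
  · obtain ⟨y, hy, hq⟩ := Multiset.mem_sum.1 hq
    obtain ⟨p, -, rfl⟩ := Multiset.mem_map.1 hq
    have hyx : y.1 ≠ x.1 := fun h => (Finset.mem_erase.1 hy).1 (Subtype.ext h)
    rw [ContinuousMap.comp_apply, localQuotient_starMap_of_disjoint hΓ.loopless hyx
      (hΓ.disjoint_stars _ _ (hW _ x.2) (hW _ y.2) (Ne.symm hyx))]
    rfl
  · change (confQuotient hΓ _ x.1 (starUnion hΓ W hW o (Function.update z₀ x y))).points = _
    rw [points_confQuotient_starUnion, ← Finset.add_sum_erase _ _ (Finset.mem_univ x)]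
    congr 1
    · simp
    · refine Finset.sum_congr rfl fun y hy => ?_
      rw [Function.update_of_ne (Finset.mem_erase.1 hy).1]

end LocalQuotients

end CellGraph

/-! ### Loops in tori -/

section Torus

variable {A : Type u} {X : Type v} [TopologicalSpace X] {Y : Type w} [TopologicalSpace Y]
  (f : C(X, Y)) (T : C(A → UnitAddCircle, X))

theorem Holonomy.toFun_zpow {G : Type z} [Group G] (H : Holonomy Y G) {y : Y}
    (q : FundamentalGroup Y y) (n : ℤ) :
    H.toFun (FundamentalGroup.toPath (q ^ n)) = H.toFun (FundamentalGroup.toPath q) ^ n :=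
  map_zpow (H.hom y) q n

/-- The holonomy of a torus whose image depends on one coordinate only. -/
theorem hom_intPowToTorus {G : Type z} [Group G] (H : Holonomy Y G) (a : A)
    (g : C(UnitAddCircle, Y)) (h : ∀ z, f (T z) = g (z a)) (n : Multiplicative (A → ℤ)) :
    ((H.pullback f).pullback T).hom 0 (CellGraph.intPowToTorus A n) =
      H.loop g ^ (Multiplicative.toAdd n a) := by
  have key : ∀ γ : ∀ _ : A, Path.Homotopic.Quotient (0 : UnitAddCircle) 0,
      ((H.pullback f).pullback T).toFun (Path.Homotopic.pi (as := fun _ : A => (0 : UnitAddCircle))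
        (bs := fun _ => 0) γ) = (H.pullback g).toFun (γ a) := by
    intro γ
    choose γ' hγ' using fun i => Path.Homotopic.Quotient.mk_surjective (γ i)
    obtain rfl : (fun i => Path.Homotopic.Quotient.mk (γ' i)) = γ := funext hγ'
    rw [Path.Homotopic.pi_lift]
    exact H.along_congr fun t => h fun i => γ' i t
  refine (key _).trans ?_
  exact (H.pullback g).toFun_zpow _ _

theorem map_changeBase {x y : X} (p : Path x y) (q : FundamentalGroup X x) :
    FundamentalGroup.map f y (FundamentalGroup.fundamentalGroupMulEquivOfPath p q) =
      FundamentalGroup.fundamentalGroupMulEquivOfPath (p.map f.continuous)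
        (FundamentalGroup.map f x q) := by
  induction q using Path.Homotopic.Quotient.ind with | _ q => ?_
  change Path x x at q
  refine congrArg Path.Homotopic.Quotient.mk ?_
  change (p.symm.trans (q.trans p)).map f.continuous = (p.map f.continuous).symm.trans
    ((q.map f.continuous).trans (p.map f.continuous))
  rw [Path.map_trans, Path.map_trans, Path.map_symm]

/-- The image of a torus is trivial in the fundamental group, if it is constant on the subtorus
spanned by the nonzero coordinates. -/
theorem map_map_intPowToTorus_eq_one (n : Multiplicative (A → ℤ))
    (h : ∀ z, (∀ a, Multiplicative.toAdd n a = 0 → z a = 0) → f (T z) = f (T 0)) :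
    FundamentalGroup.map f (T 0) (FundamentalGroup.map T 0 (CellGraph.intPowToTorus A n)) = 1 := by
  have key : ∀ γ : ∀ _ : A, Path.Homotopic.Quotient (0 : UnitAddCircle) 0,
      (∀ a, Multiplicative.toAdd n a = 0 → γ a = .refl 0) →
      Path.Homotopic.Quotient.map (Path.Homotopic.Quotient.map
        (Path.Homotopic.pi (as := fun _ : A => (0 : UnitAddCircle)) (bs := fun _ => 0) γ) T) f =
        .refl (f (T 0)) := by
    intro γ hγ
    -- The hypothesis on `f` and `T` concerns points, so the representatives at vanishing
    -- coordinates have to be constant paths, not merely nullhomotopic ones.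
    have : ∀ a, ∃ p : Path (0 : UnitAddCircle) 0, Path.Homotopic.Quotient.mk p = γ a ∧
        (Multiplicative.toAdd n a = 0 → p = Path.refl 0) := by
      intro a
      by_cases ha : Multiplicative.toAdd n a = 0
      · exact ⟨Path.refl 0, (hγ a ha).symm, fun _ => rfl⟩
      · obtain ⟨p, hp⟩ := Path.Homotopic.Quotient.mk_surjective (γ a)
        exact ⟨p, hp, fun h => absurd h ha⟩
    choose γ' hγ' hγ0 using this
    obtain rfl : (fun i => Path.Homotopic.Quotient.mk (γ' i)) = γ := funext hγ'
    rw [Path.Homotopic.pi_lift]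
    refine congrArg Path.Homotopic.Quotient.mk (Path.ext (funext fun t => ?_))
    refine h (fun i => γ' i t) fun a ha => ?_
    rw [hγ0 a ha]
    rfl
  refine key _ fun a ha => ?_
  rw [ha, zpow_zero]
  rfl

end Torus

/-! ### Detection of the toric homomorphisms -/

namespace CellGraph

theorem phi_one_eq {n : ℕ} (hn : 3 ≤ n) {c : VertexType} (h : c = .high → 4 ≤ n)
    (hc : c = .nonseparatingTrivalent) (z : UnitAddCircle) :
    phi 1 n hn c h z = phi 1 n hn c h 0 := by
  subst hc
  rfl

variable {V : Type u} {E : Type v} {Γ : CellGraph V E}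

theorem separating_of_vertexType {x : V} (h : Γ.vertexType x = .separatingTrivalent) :
    Γ.Separating x := by
  unfold vertexType at h
  split_ifs at h with h1 h2
  exact h2

theorem vertexType_of_not_separating {x : V} (h : Γ.valence x = 3) (h' : ¬ Γ.Separating x) :
    Γ.vertexType x = .nonseparatingTrivalent := by
  unfold vertexType
  rw [if_neg (by omega), if_neg h']

theorem vertexType_ne_nonseparatingTrivalent {x : V}
    (h : 4 ≤ Γ.valence x ∨ Γ.valence x = 3 ∧ Γ.Separating x) :
    Γ.vertexType x ≠ .nonseparatingTrivalent := by
  unfold vertexType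
  split_ifs with h1 h2
  · simp
  · simp
  · exact absurd (h.resolve_left h1).2 h2

variable [ConnectedSpace Γ.Space]
  (hΓ : Γ.Subdivided) {W : Finset V} (hW : ∀ x ∈ W, Γ.Essential x)
  (o : ∀ x : W, Fin (Γ.valence x) ≃ Γ.Incident x.1)
  {x₀ : B (Γ.totalSize W) Γ.Space ∅} (α : ∀ a : Fin 2, Path (torusMap hΓ W hW o a 0) x₀)

/-- The toric homomorphism followed by the detection homomorphism. -/
noncomputable def detectionToric (a : Fin 2) :=
  (detection hΓ.loopless (Γ.totalSize W) x₀).comp (toric hΓ W hW o a (α a))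

theorem detectionToric_apply (a : Fin 2) (n : Multiplicative (W → ℤ))
    (x : {x : V // Γ.Essential x}) :
    detectionToric hΓ hW o α a n x = FundamentalGroup.map (confQuotient hΓ _ x.1) x₀
      (FundamentalGroup.fundamentalGroupMulEquivOfPath (α a)
        (FundamentalGroup.map (torusMap hΓ W hW o a) 0 (intPowToTorus W n))) := rfl

/-- The conjugating element is the holonomy along the image of the path `α a`. -/
theorem hom_detectionToric (a : Fin 2) (n : Multiplicative (W → ℤ)) (x : W)
    {G : Type w} [Group G]
    (H : Holonomy (B (Γ.totalSize W) (Γ.localGraphAt x.1).Space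
      (localSinks (Γ.edgeSetoid x.1))) G)
    (g : C(UnitAddCircle, B (Γ.totalSize W) (Γ.localGraphAt x.1).Space
      (localSinks (Γ.edgeSetoid x.1))))
    (hg : ∀ z, confQuotient hΓ _ x.1 (torusMap hΓ W hW o a z) = g (z x)) :
    ∃ c : G, H.hom _ (detectionToric hΓ hW o α a n ⟨x.1, hW _ x.2⟩) =
      c * H.loop g ^ (Multiplicative.toAdd n x) * c⁻¹ := by
  refine ⟨(H.pullback (confQuotient hΓ _ x.1)).along (α a), ?_⟩
  rw [detectionToric_apply, ← hom_intPowToTorus _ _ H x g hg]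
  exact (H.pullback (confQuotient hΓ _ x.1)).hom_changeBase (α a)
    (FundamentalGroup.map (torusMap hΓ W hW o a) 0 (intPowToTorus W n))

/-- The image of the torus in the local configuration space varies only with the coordinate at `x`,
so it is constant on the relevant subtorus. If `x` is not in `W`, no condition remains. -/
theorem detectionToric_apply_eq_one (a : Fin 2) (n : Multiplicative (W → ℤ))
    (x : {x : V // Γ.Essential x})
    (h : ∀ y : W, y.1 = x.1 → Multiplicative.toAdd n y = 0 ∨
      ∀ z, phi a (Γ.valence y) (hW _ y.2) (Γ.vertexType y) Γ.four_le_valence z =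
        phi a (Γ.valence y) (hW _ y.2) (Γ.vertexType y) Γ.four_le_valence 0) :
    detectionToric hΓ hW o α a n x = 1 := by
  rw [detectionToric_apply, map_changeBase]
  refine (congrArg _ (map_map_intPowToTorus_eq_one _ _ n fun z hz => ?_)).trans (map_one _)
  refine confQuotient_starUnion_congr hΓ hW o x.2 fun y hy => ?_
  change phi a _ _ _ _ (z y) = phi a _ _ _ _ 0
  rcases h y hy with h | h
  · rw [hz y h]
  · exact h _

/-- The first part uses one and the same `H` for both toric homomorphisms; this is what disjointness
of conjugates requires, and it also yields injectivity for `a = 0`. -/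
theorem exists_separating_holonomy
    (ho : ∀ x : W, Γ.Separating x.1 → ¬ Γ.edgeSetoid x.1
      (o x ⟨0, lt_of_lt_of_le (by decide) (hW x.1 x.2)⟩)
      (o x ⟨1, lt_of_lt_of_le (by decide) (hW x.1 x.2)⟩))
    (x : W) :
    (∃ (H : Holonomy (B (Γ.totalSize W) (Γ.localGraphAt x.1).Space
        (localSinks (Γ.edgeSetoid x.1))) (Equiv.Perm (ℤ × ℤ))),
      (∀ n, H.hom _ (detectionToric hΓ hW o α 0 n ⟨x.1, hW _ x.2⟩) = 1 →
        Multiplicative.toAdd n x = 0) ∧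
      ∀ n, H.hom _ (detectionToric hΓ hW o α 1 n ⟨x.1, hW _ x.2⟩) = 1) ∧
    (Γ.vertexType x ≠ .nonseparatingTrivalent →
      ∀ n, detectionToric hΓ hW o α 1 n ⟨x.1, hW _ x.2⟩ = 1 → Multiplicative.toAdd n x = 0) := by
  obtain ⟨L, T, hL, hT, hLT⟩ := exists_local_factorization hΓ hW o x
  obtain ⟨⟨H, hH, hH'⟩, hK⟩ := exists_holonomy_phi (hW _ x.2) (o x).injective
    (localQuotient_starMap hΓ.loopless x.1 (o x)) hT (Γ.vertexType x) Γ.four_le_valence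
    (fun h => ho x (separating_of_vertexType h)) L hLT
  have hg : ∀ a z, confQuotient hΓ _ x.1 (torusMap hΓ W hW o a z) = L.comp
      (phi a (Γ.valence x) (hW _ x.2) (Γ.vertexType x) Γ.four_le_valence) (z x) := fun a z => hL _
  refine ⟨⟨H, fun n hn => ?_, fun n => ?_⟩, fun hx n hn => ?_⟩
  · obtain ⟨c, hc⟩ := hom_detectionToric hΓ hW o α 0 n x H _ (hg 0)
    rw [hc, conj_eq_one_iff] at hn
    exact hH _ hn
  · obtain ⟨c, hc⟩ := hom_detectionToric hΓ hW o α 1 n x H _ (hg 1)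
    rw [hc, hH', one_zpow, mul_one, mul_inv_cancel]
  · obtain ⟨K, hK⟩ := hK hx
    obtain ⟨c, hc⟩ := hom_detectionToric hΓ hW o α 1 n x K _ (hg 1)
    rw [hn, map_one] at hc
    exact hK _ (conj_eq_one_iff.1 hc.symm)

end CellGraph

end GraphBraid

/-! ### Proof of the proposition -/

theorem proposition7p1 {V E : Type*} [Finite V] [Finite E]
    -- a connected graph, subdivided as required
    (Γ : GraphBraid.CellGraph V E) [ConnectedSpace Γ.Space] (hΓ : Γ.Subdivided)
    -- a set of essential vertices
    (W : Finset V) (hW : ∀ x ∈ W, Γ.Essential x)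
    -- an ordering of the edges at each of these vertices, the first two of them lying in different
    -- components of the complement if the vertex is separating
    (o : ∀ x : W, Fin (Γ.valence x) ≃ Γ.Incident x.1)
    (ho : ∀ x : W, Γ.Separating x.1 → ¬ Γ.edgeSetoid x.1
      (o x ⟨0, lt_of_lt_of_le (by decide) (hW x.1 x.2)⟩)
      (o x ⟨1, lt_of_lt_of_le (by decide) (hW x.1 x.2)⟩))
    -- a basepoint and, for each value of `a`, a path to it from `φ_W^a(1)`
    (x₀ : GraphBraid.B (Γ.totalSize W) Γ.Space ∅)
    (α : ∀ a : Fin 2, Path (GraphBraid.CellGraph.torusMap hΓ W hW o a 0) x₀) :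
    Function.Injective
      ((GraphBraid.CellGraph.detection hΓ.loopless (Γ.totalSize W) x₀).comp
        (GraphBraid.CellGraph.toric hΓ W hW o 0 (α 0))) ∧
    (Function.Injective
      (((GraphBraid.CellGraph.detection hΓ.loopless (Γ.totalSize W) x₀).comp
        (GraphBraid.CellGraph.toric hΓ W hW o 1 (α 1))).domRestrict
          (GraphBraid.supportedOn ({x : W | 4 ≤ Γ.valence x.1} ∪
            {x : W | Γ.valence x.1 = 3 ∧ Γ.Separating x.1}))) ∧
      ((GraphBraid.CellGraph.detection hΓ.loopless (Γ.totalSize W) x₀).comp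
        (GraphBraid.CellGraph.toric hΓ W hW o 1 (α 1))).domRestrict
          (GraphBraid.supportedOn {x : W | Γ.valence x.1 = 3 ∧ ¬ Γ.Separating x.1}) = 1) ∧
    GraphBraid.DisjointConjugates
      ((GraphBraid.CellGraph.detection hΓ.loopless (Γ.totalSize W) x₀).comp
        (GraphBraid.CellGraph.toric hΓ W hW o 0 (α 0)))
      ((GraphBraid.CellGraph.detection hΓ.loopless (Γ.totalSize W) x₀).comp
        (GraphBraid.CellGraph.toric hΓ W hW o 1 (α 1))) := by
  have hsep := GraphBraid.CellGraph.exists_separating_holonomy hΓ hW o α ho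
  change Function.Injective (GraphBraid.CellGraph.detectionToric hΓ hW o α 0) ∧
    (Function.Injective ((GraphBraid.CellGraph.detectionToric hΓ hW o α 1).domRestrict _) ∧
      (GraphBraid.CellGraph.detectionToric hΓ hW o α 1).domRestrict _ = 1) ∧
    GraphBraid.DisjointConjugates (GraphBraid.CellGraph.detectionToric hΓ hW o α 0)
      (GraphBraid.CellGraph.detectionToric hΓ hW o α 1)
  refine ⟨?_, ⟨?_, ?_⟩, ?_⟩
  · refine (injective_iff_map_eq_one _).2 fun n hn => funext fun x => ?_
    obtain ⟨H, hH, -⟩ := (hsep x).1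
    exact hH n (by rw [hn]; exact map_one _)
  · refine (injective_iff_map_eq_one _).2 fun n hn => Subtype.ext (funext fun x => ?_)
    by_cases hx : x ∈ {x : W | 4 ≤ Γ.valence x.1} ∪
        {x : W | Γ.valence x.1 = 3 ∧ Γ.Separating x.1}
    · exact (hsep x).2 (GraphBraid.CellGraph.vertexType_ne_nonseparatingTrivalent hx) n.1
        (congrFun hn ⟨x.1, hW _ x.2⟩)
    · exact n.2 x hx
  · refine MonoidHom.ext fun n => funext fun x => ?_
    -- At a nonseparating trivalent vertex `φ¹` is constant; at any other vertex of `W` the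
    -- coordinate vanishes.
    refine GraphBraid.CellGraph.detectionToric_apply_eq_one hΓ hW o α 1 n.1 x fun y _ => ?_
    by_cases hy : y ∈ {x : W | Γ.valence x.1 = 3 ∧ ¬ Γ.Separating x.1}
    · right
      have hty := GraphBraid.CellGraph.vertexType_of_not_separating hy.1 hy.2
      exact GraphBraid.CellGraph.phi_one_eq _ _ hty
    · exact Or.inl (n.2 y hy)
  · rintro _ ⟨n, rfl⟩ g
    constructor
    · rintro ⟨m, hm⟩
      suffices h : n = 1 by rw [h, map_one]
      refine funext fun x => ?_
      -- `H` is trivial on the image of `τ¹`, hence on the given conjugate, hence on the component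
      -- of `h` at `x` itself, which forces the coordinate there to vanish.
      obtain ⟨H, hH, hH'⟩ := (hsep x).1
      refine hH n ?_
      have h := congrFun hm ⟨x.1, hW _ x.2⟩
      have h' := congrArg (H.hom _) h
      rw [hH'] at h'
      change 1 = H.hom _ (g ⟨x.1, hW _ x.2⟩ * _ * (g ⟨x.1, hW _ x.2⟩)⁻¹) at h'
      rw [map_mul, map_mul, map_inv] at h'
      exact conj_eq_one_iff.1 h'.symm
    · intro h
      rw [h, mul_one, mul_inv_cancel]
      exact one_mem _
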